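/- Let $Q$ be a smooth manifold of finite dimension, $\tau:E\to Q$ a smooth real vector bundle of finite rank $m$ and $([\![\cdot,\cdot]\!],\rho)$ a Lie algebroid structure on $E$, with anchor $\rho:E\to TQ$ and differential of functions $d^Ef(a)=df(\rho(a))$. Let $\pi:E^*\times\mathbb R\to Q$ be the projection, and let $\mathcal T^E(E^*\times\mathbb R)\to E^*\times\mathbb R$ be the prolongation of $E$ over $\pi$: the vector bundle with fibre $\{(a,v)\in E_{\pi(p)}\times T_p(E^*\times\mathbb R):\rho(a)=T\pi(v)\}$ at $p$, with the Lie algebroid structure whose anchor is $(a,v)\mapsto v$ and whose bracket has the Lie bracket of vector fields as its second component and, for sections with first components $\sum_i f_i\,(\sigma_i\circ\pi)$ and $\sum_i g_i\,(\sigma_i\circ\pi)$ and second components $X_1$, $X_2$, the first component $\sum_{i,j}f_ig_j\,([\![\sigma_i,\sigma_j]\!]\circ\pi)+\sum_i(X_1(g_i)-X_2(f_i))\,(\sigma_i\circ\pi)$, where the $\sigma_i$ are sections of $E$ and the $f_i,g_i$ are smooth functions on $E^*\times\mathbb R$. Let $d$ be its exterior differential, let $\eta$ be its contact $1$-section $\eta_{(b,s)}(a,v)=ds(v)-b(a)$,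 and let $\mathcal R$ be its Reeb section, determined by $\imath_{\mathcal R}d\eta=0$, $\imath_{\mathcal R}\eta=1$. For a smooth function $H:E^*\times\mathbb R\to\mathbb R$ let $\xi_H$ be the Hamiltonian section, determined by $\imath_{\xi_H}\eta=-H$ and $\imath_{\xi_H}d\eta=dH-\mathcal R(H)\,\eta$, where $\mathcal R(H)=dH(\mathcal R)$, and let $\mathcal E_{v_H}=\xi_H+H\mathcal R$ be the evolution section. Let $\gamma$ be a smooth section of $\pi$, and let $F_\gamma=\{(a,T\gamma(\rho(a))):a\in E\}$, a vector bundle over $\gamma(Q)$ with the Lie algebroid structure carried over from $E$ by the isomorphism $a\mapsto(a,T\gamma(\rho(a)))$. Assume that $F_\gamma$, with its inclusion in $\mathcal T^E(E^*\times\mathbb R)$, is a Legendrian Lie subalgebroid: the inclusion is an injective Lie algebroid morphism over an injective immersion, the rank of $F_\gamma$ is $k$ where $2k+1$ is the rank of $\mathcal T^E(E^*\times\mathbb R)$, and $\eta$ vanishes on $F_\gamma$. Let $\mathcal E_{v_H}^\gamma=\mathrm{pr}_1\circ\mathcal E_{v_H}\circ\gamma$, a section of $E$. Then $\mathcal E_{v_H}$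 and $\mathcal E_{v_H}^\gamma$ are $\gamma$-related, that is, $\mathcal E_{v_H}\circ\gamma=(\mathrm{Id}_E,T\gamma\circ\rho)\circ\mathcal E_{v_H}^\gamma$, if and only if $d^E(H\circ\gamma)=0$ on $Q$. -/

import Mathlib

open Bundle Set Filter Topology
open scoped Manifold ContDiff Bundle

noncomputable section

/-! ### Exterior calculus of an algebroid -/

section Pre

/-- The derivative `v f` of a function `f` along the tangent vector `v` at `x`. -/
def dirDeriv {V H M : Type*} [NormedAddCommGroup V] [NormedSpace ℝ V] [TopologicalSpace H]
    (I : ModelWithCorners ℝ V H) [TopologicalSpace M] [ChartedSpace H M] (f : M → ℝ) (x : M) :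
    TangentSpace I x →ₗ[ℝ] ℝ :=
  (mfderiv I 𝓘(ℝ, ℝ) f x).toLinearMap

/-- The data that the exterior calculus of a Lie algebroid uses: a family of fibres over the
manifold `M`, the predicate that singles out the smooth sections, the anchor, and the bracket of
sections (meaningful on smooth sections only). The laws of a Lie algebroid are in `LieAlgebroid`;
this record is only ever used for a `LieAlgebroid` and for the prolongation built from it. -/
structure AlgebroidData {V H M : Type*} [NormedAddCommGroup V] [NormedSpace ℝ V]
    [TopologicalSpace H] (I : ModelWithCorners ℝ V H) [TopologicalSpace M] [ChartedSpace H M]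
    (A : M → Type*) [∀ x, AddCommGroup (A x)] [∀ x, Module ℝ (A x)] where
  IsSmooth : (∀ x, A x) → Prop
  anchor : ∀ x, A x →ₗ[ℝ] TangentSpace I x
  bracket : (∀ x, A x) → (∀ x, A x) → ∀ x, A x

namespace AlgebroidData

variable {V H M : Type*} [NormedAddCommGroup V] [NormedSpace ℝ V] [TopologicalSpace H]
  {I : ModelWithCorners ℝ V H} [TopologicalSpace M] [ChartedSpace H M]
  {A : M → Type*} [∀ x, AddCommGroup (A x)] [∀ x, Module ℝ (A x)]
  (𝒜 : AlgebroidData I A)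

/-- `d f`, the differential of a function: `(d f)(a) = ρ(a) f`. -/
def dFun (f : M → ℝ) (x : M) : A x →ₗ[ℝ] ℝ :=
  dirDeriv I f x ∘ₗ 𝒜.anchor x

/-- `k`-sections (sections of `⋀ᵏ A*`) that are smooth, tested on smooth sections. -/
def IsSmoothForm {k : ℕ} (θ : ∀ x, A x [⋀^Fin k]→ₗ[ℝ] ℝ) : Prop :=
  ∀ σ : Fin k → ∀ x, A x, (∀ i, 𝒜.IsSmooth (σ i)) →
    ContMDiff I 𝓘(ℝ, ℝ) ∞ fun x => θ x fun i => σ i x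

/-- The exterior differential evaluated on sections,
`(d θ)(σ₀, …, σₖ) = ∑ᵢ (-1)ⁱ ρ(σᵢ) θ(…, σ̂ᵢ, …) + ∑_{i<j} (-1)^{i+j} θ(⟦σᵢ, σⱼ⟧, …, σ̂ᵢ, …, σ̂ⱼ, …)`.

In the second sum the pair `i < j` is written as `i` together with the position `j - 1 ≥ i` of `σⱼ`
in the list without `σᵢ`, and the bracket is left at that position; moving it to the front costs
the sign `(-1)^{j-1}`, so that the sign here is `(-1)^{i+1}`. -/
def evalD {k : ℕ} (θ : ∀ x, A x [⋀^Fin k]→ₗ[ℝ] ℝ) (σ : Fin (k + 1) → ∀ x, A x) (x : M) : ℝ :=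
  (∑ i : Fin (k + 1), (-1 : ℝ) ^ (i : ℕ) *
    𝒜.dFun (fun y => θ y fun l => σ (i.succAbove l) y) x (σ i x)) +
  ∑ i : Fin (k + 1), ∑ j : Fin k,
    if (i : ℕ) ≤ (j : ℕ) then
      (-1 : ℝ) ^ ((i : ℕ) + 1) *
        θ x (Function.update (fun l => σ (i.succAbove l) x) j
          (𝒜.bracket (σ i) (σ (i.succAbove j)) x))
    else 0

/-- A smooth section with the value `a` at `x`. -/
def extend (x : M) (a : A x) : ∀ y, A y :=
  Classical.epsilon fun σ => 𝒜.IsSmooth σ ∧ σ x = a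

/-- The exterior differential at a point. By tensoriality the value does not depend on the smooth
sections through the given vectors. -/
def extDeriv {k : ℕ} (θ : ∀ x, A x [⋀^Fin k]→ₗ[ℝ] ℝ) (x : M) (v : Fin (k + 1) → A x) : ℝ :=
  𝒜.evalD θ (fun i => 𝒜.extend x (v i)) x

/-- A `1`-section as an alternating form of degree one. -/
def oneForm (η : ∀ x, A x →ₗ[ℝ] ℝ) (x : M) : A x [⋀^Fin 1]→ₗ[ℝ] ℝ :=
  AlternatingMap.ofSubsingleton ℝ (A x) ℝ (0 : Fin 1) (η x)

/-- `(d η)_x (a, b)` for a `1`-section `η`. -/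
def dOne (η : ∀ x, A x →ₗ[ℝ] ℝ) (x : M) (a b : A x) : ℝ :=
  𝒜.extDeriv (oneForm η) x ![a, b]

/-- The conditions `i_R dη = 0`, `i_R η = 1` on the Reeb section. They determine every value of `R`
for a contact `1`-section `η`. -/
def IsReeb (η : ∀ x, A x →ₗ[ℝ] ℝ) (R : ∀ x, A x) : Prop :=
  (∀ x b, 𝒜.dOne η x (R x) b = 0) ∧ ∀ x, η x (R x) = 1

/-- The Reeb section of a contact `1`-section `η`. -/
def reeb (η : ∀ x, A x →ₗ[ℝ] ℝ) : ∀ x, A x :=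
  Classical.epsilon (𝒜.IsReeb η)

/-- The conditions `i_ξ η = -H`, `i_ξ dη = dH - ρ(R)(H) η` on the Hamiltonian section. They
determine every value of `ξ` for a contact `1`-section `η`. -/
def IsHamiltonian (η : ∀ x, A x →ₗ[ℝ] ℝ) (h : M → ℝ) (ξ : ∀ x, A x) : Prop :=
  (∀ x, η x (ξ x) = -h x) ∧
    ∀ x b, 𝒜.dOne η x (ξ x) b = 𝒜.dFun h x b - 𝒜.dFun h x (𝒜.reeb η x) * η x b

/-- The Hamiltonian section `ξ_h` of a contact `1`-section `η`. -/
def hamiltonian (η : ∀ x, A x →ₗ[ℝ] ℝ) (h : M → ℝ) : ∀ x, A x :=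
  Classical.epsilon (𝒜.IsHamiltonian η h)

/-- The evolution section `ξ_h + h R`. -/
def evolution (η : ∀ x, A x →ₗ[ℝ] ℝ) (h : M → ℝ) (x : M) : A x :=
  𝒜.hamiltonian η h x + h x • 𝒜.reeb η x

variable {V' H' N : Type*} [NormedAddCommGroup V'] [NormedSpace ℝ V'] [TopologicalSpace H']
  {I' : ModelWithCorners ℝ V' H'} [TopologicalSpace N] [ChartedSpace H' N]
  {B : N → Type*} [∀ x, AddCommGroup (B x)] [∀ x, Module ℝ (B x)]

/-- The pull-back of a `k`-section along the bundle map `(j, i)`. -/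
def pullback {i : N → M} (j : ∀ x, B x →ₗ[ℝ] A (i x)) {k : ℕ}
    (θ : ∀ x, A x [⋀^Fin k]→ₗ[ℝ] ℝ) (x : N) : B x [⋀^Fin k]→ₗ[ℝ] ℝ :=
  (θ (i x)).compLinearMap (j x)

/-- `(j, i)`, with `j : B → A` over `i : N → M`, is a morphism of Lie algebroids: a smooth bundle
map such that `d ((j, i)* θ) = (j, i)* (d θ)` for every smooth `k`-section `θ` and every `k`. -/
structure IsMorphism (𝒜 : AlgebroidData I A) (ℬ : AlgebroidData I' B) (i : N → M)
    (j : ∀ x, B x →ₗ[ℝ] A (i x)) : Prop where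
  contMDiff : ContMDiff I' I ∞ i
  smooth_pullback : ∀ (k : ℕ) (θ : ∀ x, A x [⋀^Fin k]→ₗ[ℝ] ℝ), 𝒜.IsSmoothForm θ →
    ℬ.IsSmoothForm (pullback j θ)
  comm_d : ∀ (k : ℕ) (θ : ∀ x, A x [⋀^Fin k]→ₗ[ℝ] ℝ), 𝒜.IsSmoothForm θ →
    ∀ (x : N) (b : Fin (k + 1) → B x),
      ℬ.extDeriv (pullback j θ) x b = 𝒜.extDeriv θ (i x) fun l => j x (b l)

/-- A Lie subalgebroid: a morphism `(j, i)` with `j` injective on fibres and `i` an injective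
immersion. -/
structure IsSubalgebroid (𝒜 : AlgebroidData I A) (ℬ : AlgebroidData I' B) (i : N → M)
    (j : ∀ x, B x →ₗ[ℝ] A (i x)) : Prop extends IsMorphism 𝒜 ℬ i j where
  injective_fibre : ∀ x, Function.Injective (j x)
  injective_base : Function.Injective i
  immersion : ∀ x, Function.Injective (mfderiv I' I i x)

/-- A Legendrian Lie subalgebroid with respect to the contact `1`-section `η`: the ambient rank is
`2k + 1`, the rank of the subalgebroid is `k`, and `η` vanishes on it. -/
structure IsLegendrian (𝒜 : AlgebroidData I A) (η : ∀ x, A x →ₗ[ℝ] ℝ) (ℬ : AlgebroidData I' B)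
    (i : N → M) (j : ∀ x, B x →ₗ[ℝ] A (i x)) : Prop extends IsSubalgebroid 𝒜 ℬ i j where
  rank : ∃ k : ℕ, (∀ y, Module.finrank ℝ (A y) = 2 * k + 1) ∧ ∀ x, Module.finrank ℝ (B x) = k
  vanishes : ∀ (x : N) (b : B x), η (i x) (j x b) = 0

end AlgebroidData

end Pre

/-! ### Lie algebroids and their prolongations -/

section Algebroid

variable {V F Q : Type*} [NormedAddCommGroup V] [NormedSpace ℝ V]
  [NormedAddCommGroup F] [NormedSpace ℝ F]
  [TopologicalSpace Q] [ChartedSpace V Q] [IsManifold 𝓘(ℝ, V) ∞ Q]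
  {E : Q → Type*} [∀ q, AddCommGroup (E q)] [∀ q, Module ℝ (E q)] [∀ q, TopologicalSpace (E q)]
  [TopologicalSpace (TotalSpace F E)] [FiberBundle F E]

variable (V F) in
/-- Smooth sections of the vector bundle `E`. -/
def SmoothSection (σ : ∀ q, E q) : Prop :=
  ContMDiff 𝓘(ℝ, V) (𝓘(ℝ, V).prod 𝓘(ℝ, F)) ∞ fun q => TotalSpace.mk' F q (σ q)

variable (V F E) in
/-- A Lie algebroid structure on the vector bundle `E → Q`: a smooth bundle map `ρ : E → TQ` over
the identity and a Lie bracket on the smooth sections with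
`⟦σ, f τ⟧ = f ⟦σ, τ⟧ + (ρ(σ) f) τ`. (The bracket of sections that are not both smooth is never
used.) -/
structure LieAlgebroid where
  anchor : ∀ q, E q →ₗ[ℝ] TangentSpace 𝓘(ℝ, V) q
  contMDiff_anchor : ContMDiff (𝓘(ℝ, V).prod 𝓘(ℝ, F)) 𝓘(ℝ, V).tangent ∞
    fun a : TotalSpace F E => (⟨a.proj, anchor a.proj a.2⟩ : TangentBundle 𝓘(ℝ, V) Q)
  bracket : (∀ q, E q) → (∀ q, E q) → ∀ q, E q
  smooth_bracket : ∀ σ τ, SmoothSection V F σ → SmoothSection V F τ →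
    SmoothSection V F (bracket σ τ)
  bracket_add : ∀ σ τ υ, SmoothSection V F σ → SmoothSection V F τ → SmoothSection V F υ →
    bracket σ (τ + υ) = bracket σ τ + bracket σ υ
  bracket_smul : ∀ (c : ℝ) (σ τ : ∀ q, E q), SmoothSection V F σ → SmoothSection V F τ →
    bracket σ (c • τ) = c • bracket σ τ
  bracket_antisymm : ∀ σ τ, SmoothSection V F σ → SmoothSection V F τ →
    bracket σ τ = -bracket τ σ
  jacobi : ∀ σ τ υ, SmoothSection V F σ → SmoothSection V F τ → SmoothSection V F υ →
    bracket σ (bracket τ υ) + bracket τ (bracket υ σ) + bracket υ (bracket σ τ) = 0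
  leibniz : ∀ (f : Q → ℝ) (σ τ : ∀ q, E q), ContMDiff 𝓘(ℝ, V) 𝓘(ℝ, ℝ) ∞ f →
    SmoothSection V F σ → SmoothSection V F τ → ∀ q,
      bracket σ (fun q => f q • τ q) q =
        f q • bracket σ τ q + dirDeriv 𝓘(ℝ, V) f q (anchor q (σ q)) • τ q

namespace LieAlgebroid

variable (𝓔 : LieAlgebroid V F E)

/-- The data of the exterior calculus of `E`. -/
def data : AlgebroidData 𝓘(ℝ, V) E where
  IsSmooth := SmoothSection V F
  anchor := 𝓔.anchor
  bracket := 𝓔.bracket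

section Prolongation

variable {W K P : Type*} [NormedAddCommGroup W] [NormedSpace ℝ W] [TopologicalSpace K]
  (J : ModelWithCorners ℝ W K) [TopologicalSpace P] [ChartedSpace K P]
  [IsManifold J ∞ P] (pr : P → Q)

/-- The fibre at `p` of the prolongation of `E` over `pr : P → Q`:
the pairs `(a, v)` in `E_{pr p} × T_p P` with `ρ(a) = Tpr(v)`. -/
def Prol (p : P) : Submodule ℝ (E (pr p) × TangentSpace J p) :=
  LinearMap.eqLocus
    (𝓔.anchor (pr p) ∘ₗ LinearMap.fst ℝ (E (pr p)) (TangentSpace J p))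
    ((mfderiv J 𝓘(ℝ, V) pr p).toLinearMap ∘ₗ LinearMap.snd ℝ (E (pr p)) (TangentSpace J p))

variable {J pr} in
/-- Smooth sections of the prolongation: both components are smooth. -/
def ProlSmooth (Z : ∀ p, 𝓔.Prol J pr p) : Prop :=
  ContMDiff J (𝓘(ℝ, V).prod 𝓘(ℝ, F)) ∞ (fun p => TotalSpace.mk' F (pr p) (Z p).1.1) ∧
    ContMDiff J J.tangent ∞ fun p => (⟨p, (Z p).1.2⟩ : TangentBundle J P)

variable {J pr} in
/-- `w` is the value at `p` of the bracket of the sections `Z₁ = (a₁, X₁)` and `Z₂ = (a₂, X₂)`.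
Its second component is `[X₁, X₂]`. Whenever `a₁ = ∑ fᵢ (σᵢ ∘ pr)` and `a₂ = ∑ gᵢ (σᵢ ∘ pr)` near
`p` for smooth sections `σᵢ` of `E` and smooth functions `fᵢ`, `gᵢ` on `P`, the first component is
`∑ᵢⱼ fᵢ gⱼ (⟦σᵢ, σⱼ⟧ ∘ pr) + ∑ᵢ (X₁ gᵢ - X₂ fᵢ) (σᵢ ∘ pr)`. -/
def IsProlBracket (Z₁ Z₂ : ∀ p, 𝓔.Prol J pr p) (p : P) (w : 𝓔.Prol J pr p) : Prop :=
  w.1.2 = VectorField.mlieBracket J (fun p => (Z₁ p).1.2) (fun p => (Z₂ p).1.2) p ∧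
  ∀ (r : ℕ) (σ : Fin r → ∀ q, E q) (f g : Fin r → P → ℝ),
    (∀ i, SmoothSection V F (σ i)) →
    (∀ i, ContMDiff J 𝓘(ℝ, ℝ) ∞ (f i)) → (∀ i, ContMDiff J 𝓘(ℝ, ℝ) ∞ (g i)) →
    (∀ᶠ y in 𝓝 p, (Z₁ y).1.1 = ∑ i, f i y • σ i (pr y)) →
    (∀ᶠ y in 𝓝 p, (Z₂ y).1.1 = ∑ i, g i y • σ i (pr y)) →
    w.1.1 = ∑ i, ∑ j, (f i p * g j p) • 𝓔.bracket (σ i) (σ j) (pr p) +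
      ∑ i, (dirDeriv J (g i) p (Z₁ p).1.2 - dirDeriv J (f i) p (Z₂ p).1.2) • σ i (pr p)

/-- The prolongation `𝒯ᴱP`, with anchor `(a, v) ↦ v`. -/
def prolongation : AlgebroidData J (fun p => 𝓔.Prol J pr p) where
  IsSmooth := 𝓔.ProlSmooth
  anchor p := LinearMap.snd ℝ (E (pr p)) (TangentSpace J p) ∘ₗ (𝓔.Prol J pr p).subtype
  bracket Z₁ Z₂ p := Classical.epsilon (𝓔.IsProlBracket Z₁ Z₂ p)

end Prolongation

end LieAlgebroid

end Algebroid

/-! ### The contact structure on the prolongation over `E* × ℝ` -/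

section Contact

variable {V F Q : Type*} [NormedAddCommGroup V] [NormedSpace ℝ V]
  [NormedAddCommGroup F] [NormedSpace ℝ F]
  [TopologicalSpace Q] [ChartedSpace V Q] [IsManifold 𝓘(ℝ, V) ∞ Q]
  {E : Q → Type*} [∀ q, AddCommGroup (E q)] [∀ q, Module ℝ (E q)] [∀ q, TopologicalSpace (E q)]
  [TopologicalSpace (TotalSpace F E)] [FiberBundle F E] [VectorBundle ℝ F E]
  [ContMDiffVectorBundle ∞ F E 𝓘(ℝ, V)]

variable (F E) in
/-- The manifold `E* × ℝ`; a point is `(⟨q, b⟩, s)` with `b` a linear form on `E q`. -/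
abbrev PhaseSpace : Type _ :=
  TotalSpace (F →L[ℝ] ℝ) (fun q : Q => E q →L[ℝ] Bundle.Trivial Q ℝ q) × ℝ

variable (V F) in
/-- The model of `E* × ℝ`. -/
abbrev phaseModel :=
  (𝓘(ℝ, V).prod 𝓘(ℝ, F →L[ℝ] ℝ)).prod 𝓘(ℝ, ℝ)

variable (F E) in
/-- The projection `E* × ℝ → Q`. -/
def phaseProj (p : PhaseSpace F E) : Q := p.1.proj

variable (V F E) in
/-- A smooth section `γ = (γ₀, γ_s)` of `E* × ℝ → Q`. -/
structure PhaseSection where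
  form : ∀ q, E q →L[ℝ] Bundle.Trivial Q ℝ q
  fn : Q → ℝ
  smooth : ContMDiff 𝓘(ℝ, V) (phaseModel V F) ∞
    fun q => ((⟨q, form q⟩, fn q) : PhaseSpace F E)

/-- The map `γ : Q → E* × ℝ`. -/
def PhaseSection.map (γ : PhaseSection V F E) (q : Q) : PhaseSpace F E := (⟨q, γ.form q⟩, γ.fn q)

namespace LieAlgebroid

variable (𝓔 : LieAlgebroid V F E)

/-- The contact Hamiltonian prolongation `𝒯ᴱ(E* × ℝ)`. -/
abbrev contactProl :=
  𝓔.prolongation (phaseModel V F) (phaseProj F E)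

/-- The contact `1`-section `η = 𝒱ˢ - Θ`, that is, `η_{(b, s)}(a, v) = ds(v) - b(a)`. -/
def contactForm (p : PhaseSpace F E) : 𝓔.Prol (phaseModel V F) (phaseProj F E) p →ₗ[ℝ] ℝ :=
  (dirDeriv (phaseModel V F) (Prod.snd : PhaseSpace F E → ℝ) p ∘ₗ
      LinearMap.snd ℝ (E p.1.proj) (TangentSpace (phaseModel V F) p) -
    (p.1.2.toLinearMap : E p.1.proj →ₗ[ℝ] ℝ) ∘ₗ
      LinearMap.fst ℝ (E p.1.proj) (TangentSpace (phaseModel V F) p)) ∘ₗ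
  (𝓔.Prol (phaseModel V F) (phaseProj F E) p).subtype

theorem mfderiv_phaseProj_section (γ : PhaseSection V F E) (q : Q) (v : TangentSpace 𝓘(ℝ, V) q) :
    mfderiv (phaseModel V F) 𝓘(ℝ, V) (phaseProj F E) (γ.map q)
      (mfderiv 𝓘(ℝ, V) (phaseModel V F) γ.map q v) = v := by
  have h1 : MDifferentiableAt 𝓘(ℝ, V) (phaseModel V F) γ.map q :=
    (γ.smooth.mdifferentiable (by simp)) q
  have h2 : MDifferentiableAt (phaseModel V F) 𝓘(ℝ, V) (phaseProj F E) (γ.map q) :=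
    ((Bundle.contMDiff_proj (n := ∞) (F := F →L[ℝ] ℝ) (IB := 𝓘(ℝ, V))
      (fun q : Q => E q →L[ℝ] Bundle.Trivial Q ℝ q)).comp contMDiff_fst).mdifferentiable
        (by simp) (γ.map q)
  have h3 := mfderiv_comp q h2 h1
  have h4 : phaseProj F E ∘ γ.map = id := rfl
  rw [h4, mfderiv_id] at h3
  exact (congrArg (fun L => L v) h3).symm

/-- The bundle map `(Id_E, Tγ ∘ ρ) : E → 𝒯ᴱ(E* × ℝ)` over `γ`, `a ↦ (a, Tγ(ρ(a)))`. Its image is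
the vector bundle `F_γ` over `γ(Q)`; it is a vector bundle isomorphism of `E` with `F_γ`, through
which `F_γ` carries its Lie algebroid structure. -/
def graphMap (γ : PhaseSection V F E) (q : Q) :
    E q →ₗ[ℝ] 𝓔.Prol (phaseModel V F) (phaseProj F E) (γ.map q) :=
  LinearMap.codRestrict (𝓔.Prol (phaseModel V F) (phaseProj F E) (γ.map q))
    (LinearMap.prod LinearMap.id
      ((mfderiv 𝓘(ℝ, V) (phaseModel V F) γ.map q).toLinearMap ∘ₗ 𝓔.anchor q))
    fun a => (mfderiv_phaseProj_section γ q (𝓔.anchor q a)).symm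

/-- The section `γ` is Legendrian: `F_γ → γ(Q)`, with its inclusion in `𝒯ᴱ(E* × ℝ)`, is a
Legendrian Lie subalgebroid for the contact `1`-section `η`. -/
def IsLegendrianSection (γ : PhaseSection V F E) : Prop :=
  AlgebroidData.IsLegendrian 𝓔.contactProl 𝓔.contactForm 𝓔.data γ.map (𝓔.graphMap γ)

/-- The evolution section `ℰ_H = ξ_H + H R` of `𝒯ᴱ(E* × ℝ)`. -/
def evolutionSection (H : PhaseSpace F E → ℝ) (p : PhaseSpace F E) :
    𝓔.Prol (phaseModel V F) (phaseProj F E) p :=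
  𝓔.contactProl.evolution 𝓔.contactForm H p

/-- The section `Z^γ = pr₁ ∘ Z ∘ γ` of `E` induced by a section `Z` of `𝒯ᴱ(E* × ℝ)`. -/
def inducedSection (γ : PhaseSection V F E)
    (Z : ∀ p, 𝓔.Prol (phaseModel V F) (phaseProj F E) p) (q : Q) : E q :=
  (Z (γ.map q)).1.1

/-- A section `Z` of `𝒯ᴱ(E* × ℝ)` and a section `σ` of `E` are `γ`-related:
`Z ∘ γ = (Id_E, Tγ ∘ ρ) ∘ σ`. -/
def GammaRelated (γ : PhaseSection V F E)
    (Z : ∀ p, 𝓔.Prol (phaseModel V F) (phaseProj F E) p) (σ : ∀ q, E q) : Prop :=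
  ∀ q, Z (γ.map q) = 𝓔.graphMap γ q (σ q)

end LieAlgebroid

end Contact

end

/-!
Write `μ_σ(b, s) = b(σ)` for the momentum function of a section `σ` of `E`. If `eₖ` is a local frame
of `E`, then
`dη((a, v), (b, w)) = ∑ₖ aₖ w(μ_{eₖ}) - ∑ₖ bₖ v(μ_{eₖ}) + ∑ₖₗ aₖ bₗ μ_⟦eₖ, eₗ⟧`,
so `dη` is nondegenerate on `ker η`, the Reeb section is `(0, ∂/∂s)`, and the evolution section is
the section of `ker η` with `dη(ℰ_H, w) = dH(w)` for all `w` in `ker η`. If `η` vanishes on `F_γ`,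
then `μ_σ ∘ γ = ρ(σ) γ_s` for every `σ`, and `ρ⟦σ, τ⟧ = [ρ(σ), ρ(τ)]` turns the formula into
`dη = 0` on `F_γ`. An element of `ker η` over `0 ∈ E` that is `dη`-orthogonal to `F_γ` is zero, so
`F_γ` is its own orthogonal complement in `ker η`. Hence `ℰ_H ∘ γ` takes values in `F_γ` if and only
if `dH` vanishes on `F_γ`, that is, if and only if `dᴱ(H ∘ γ) = 0`.
-/

noncomputable section

theorem two_le_infty : (2 : WithTop ℕ∞) ≤ ∞ :=
  WithTop.coe_le_coe.2 le_top

section DirDeriv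

variable {V H M : Type*} [NormedAddCommGroup V] [NormedSpace ℝ V] [TopologicalSpace H]
  {I : ModelWithCorners ℝ V H} [TopologicalSpace M] [ChartedSpace H M]
  {f g : M → ℝ} {x : M}

theorem dirDeriv_congr (h : f =ᶠ[𝓝 x] g) : dirDeriv I f x = dirDeriv I g x :=
  congrArg ContinuousLinearMap.toLinearMap h.mfderiv_eq

@[simp]
theorem dirDeriv_const (c : ℝ) : dirDeriv I (fun _ : M => c) x = 0 :=
  congrArg ContinuousLinearMap.toLinearMap mfderiv_const

theorem dirDeriv_sub (hf : MDifferentiableAt I 𝓘(ℝ, ℝ) f x)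
    (hg : MDifferentiableAt I 𝓘(ℝ, ℝ) g x) (v : TangentSpace I x) :
    dirDeriv I (fun y => f y - g y) x v = dirDeriv I f x v - dirDeriv I g x v :=
  congrArg (fun L => L v) (mfderiv_sub hf hg)

theorem dirDeriv_mul (hf : MDifferentiableAt I 𝓘(ℝ, ℝ) f x)
    (hg : MDifferentiableAt I 𝓘(ℝ, ℝ) g x) (v : TangentSpace I x) :
    dirDeriv I (fun y => f y * g y) x v = f x * dirDeriv I g x v + g x * dirDeriv I f x v :=
  congrArg (fun L => L v) (hf.hasMFDerivAt.mul hg.hasMFDerivAt).mfderiv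

theorem dirDeriv_sum_mul {ι : Type} (s : Finset ι) {f g : ι → M → ℝ}
    (hf : ∀ i ∈ s, MDifferentiableAt I 𝓘(ℝ, ℝ) (f i) x)
    (hg : ∀ i ∈ s, MDifferentiableAt I 𝓘(ℝ, ℝ) (g i) x) (v : TangentSpace I x) :
    dirDeriv I (fun y => ∑ i ∈ s, f i y * g i y) x v =
      ∑ i ∈ s, (f i x * dirDeriv I (g i) x v + g i x * dirDeriv I (f i) x v) := by
  have hsum : HasMFDerivAt I 𝓘(ℝ, ℝ) (∑ i ∈ s, f i * g i) x
      (∑ i ∈ s, mfderiv I 𝓘(ℝ, ℝ) (f i * g i) x) :=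
    HasMFDerivAt.sum fun i hi => ((hf i hi).mul (hg i hi)).hasMFDerivAt
  have hfun : (fun y => ∑ i ∈ s, f i y * g i y) = ∑ i ∈ s, f i * g i := by
    ext y
    simp
  rw [hfun, dirDeriv, hsum.mfderiv]
  refine Eq.trans ?_ (Finset.sum_congr rfl fun i hi => dirDeriv_mul (hf i hi) (hg i hi) v)
  exact sum_apply (F := TangentSpace I x →L[ℝ] ℝ) s _ v

theorem dirDeriv_comp {V' H' N : Type*} [NormedAddCommGroup V'] [NormedSpace ℝ V']
    [TopologicalSpace H'] {I' : ModelWithCorners ℝ V' H'} [TopologicalSpace N] [ChartedSpace H' N]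
    {φ : N → M} {y : N} (hf : MDifferentiableAt I 𝓘(ℝ, ℝ) f (φ y))
    (hφ : MDifferentiableAt I' I φ y) (v : TangentSpace I' y) :
    dirDeriv I' (fun y => f (φ y)) y v = dirDeriv I f (φ y) (mfderiv I' I φ y v) :=
  congrArg (fun L => L v) (mfderiv_comp y hf hφ)

theorem dirDeriv_continuousLinearMap (l : V →L[ℝ] ℝ) (z : V) (v : TangentSpace 𝓘(ℝ, V) z) :
    dirDeriv 𝓘(ℝ, V) l z v = l v :=
  congrArg (fun L => L v) l.mfderiv_eq

section Smooth

variable [IsManifold I ∞ M]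

theorem contMDiff_dirDeriv (hf : ContMDiff I 𝓘(ℝ, ℝ) ∞ f) {X : ∀ x, TangentSpace I x}
    (hX : ContMDiff I I.tangent ∞ fun x => (⟨x, X x⟩ : TangentBundle I M)) :
    ContMDiff I 𝓘(ℝ, ℝ) ∞ fun x => dirDeriv I f x (X x) :=
  (contMDiff_snd_tangentBundle_modelSpace ℝ 𝓘(ℝ, ℝ)).comp
    ((hf.contMDiff_tangentMap (m := ∞) (by simp)).comp hX)

theorem mfderiv_extChartAt_injective {x₀ : M} (hx : x ∈ (extChartAt I x₀).source) :
    Function.Injective (mfderiv I 𝓘(ℝ, V) (extChartAt I x₀) x) :=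
  have : IsManifold I 1 M := IsManifold.of_le (n := ∞) (by simp)
  (isInvertible_mfderiv_extChartAt hx).injective

theorem eq_of_forall_dirDeriv_eq [FiniteDimensional ℝ V] [T2Space M] {v w : TangentSpace I x}
    (h : ∀ f : M → ℝ, ContMDiff I 𝓘(ℝ, ℝ) ∞ f → dirDeriv I f x v = dirDeriv I f x w) :
    v = w := by
  apply mfderiv_extChartAt_injective (mem_extChartAt_source (I := I) x)
  by_contra hne
  obtain ⟨l, hl⟩ := SeparatingDual.exists_separating_of_ne (R := ℝ) (V := V) hne
  obtain ⟨χ⟩ : Nonempty (SmoothBumpFunction I x) := inferInstance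
  have hcoord : ∀ u : TangentSpace I x,
      dirDeriv I (fun y => χ y • l (extChartAt I x y)) x u =
        l (mfderiv I 𝓘(ℝ, V) (extChartAt I x) x u) := by
    intro u
    have hχ : (fun y => χ y • l (extChartAt I x y)) =ᶠ[𝓝 x] fun y => l (extChartAt I x y) := by
      filter_upwards [χ.eventuallyEq_one] with y hy
      simp [hy]
    rw [dirDeriv_congr hχ, dirDeriv_comp l.mdifferentiableAt
      (mdifferentiableAt_extChartAt (mem_chart_source H x)), dirDeriv_continuousLinearMap]
  apply hl
  rw [← hcoord v, ← hcoord w]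
  exact h _ (χ.contMDiff_smul fun y hy =>
    (l.contMDiff.contMDiffAt.comp y (contMDiffAt_extChartAt' hy)).contMDiffWithinAt)

variable (I) in
/-- The vector field `X` read in the extended chart at `x`. -/
def chartField (x : M) (X : ∀ y : M, TangentSpace I y) : V → V :=
  VectorField.mpullbackWithin 𝓘(ℝ, V) I (extChartAt I x).symm X (range I)

variable [I.Boundaryless] {X Y : ∀ x : M, TangentSpace I x}

theorem fderiv_chartField {z : V} (hz : z ∈ (extChartAt I x).target)
    (hf : MDifferentiableAt I 𝓘(ℝ, ℝ) f ((extChartAt I x).symm z)) :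
    fderiv ℝ (f ∘ (extChartAt I x).symm) z (chartField I x X z : V) =
      dirDeriv I f ((extChartAt I x).symm z) (X ((extChartAt I x).symm z)) := by
  have : IsManifold I 1 M := IsManifold.of_le (n := ∞) (by simp)
  have hinv := isInvertible_mfderivWithin_extChartAt_symm (I := I) hz
  have hd := mdifferentiableWithinAt_extChartAt_symm (I := I) hz
  rw [I.range_eq_univ] at hinv hd
  rw [mfderivWithin_univ] at hinv
  have hfield : mfderiv 𝓘(ℝ, V) I (extChartAt I x).symm z (chartField I x X z : V) =
      X ((extChartAt I x).symm z) := by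
    rw [chartField, VectorField.mpullbackWithin_apply, I.range_eq_univ, mfderivWithin_univ]
    exact hinv.self_apply_inverse _
  rw [← mfderiv_eq_fderiv, ← hfield]
  exact dirDeriv_comp hf (mdifferentiableWithinAt_univ.1 hd) (chartField I x X z : V)

theorem dirDeriv_eq_fderiv_extChartAt (hf : MDifferentiableAt I 𝓘(ℝ, ℝ) f x)
    (v : TangentSpace I x) :
    dirDeriv I f x v = fderiv ℝ (f ∘ (extChartAt I x).symm) (extChartAt I x x)
      (mfderiv I 𝓘(ℝ, V) (extChartAt I x) x v) := by
  have : IsManifold I 1 M := IsManifold.of_le (n := ∞) (by simp)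
  have hφ : MDifferentiableAt I 𝓘(ℝ, V) (extChartAt I x) x :=
    mdifferentiableAt_extChartAt (mem_chart_source H x)
  have hsymm : MDifferentiableAt 𝓘(ℝ, V) I (extChartAt I x).symm (extChartAt I x x) := by
    have h := mdifferentiableWithinAt_extChartAt_symm (I := I) (mem_extChartAt_target x)
    rwa [I.range_eq_univ, mdifferentiableWithinAt_univ] at h
  rw [← extChartAt_to_inv (I := I) x] at hf
  have hchart : f =ᶠ[𝓝 x] fun y => (f ∘ (extChartAt I x).symm) (extChartAt I x y) := by
    filter_upwards [extChartAt_source_mem_nhds (I := I) x] with y hy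
    exact congrArg f ((extChartAt I x).left_inv hy).symm
  rw [dirDeriv_congr hchart, dirDeriv_comp (hf.comp _ hsymm) hφ, dirDeriv, mfderiv_eq_fderiv]
  rfl

theorem differentiableAt_chartField [CompleteSpace V]
    (hX : ContMDiff I I.tangent ∞ fun x => (⟨x, X x⟩ : TangentBundle I M)) (x : M) :
    DifferentiableAt ℝ (chartField I x X) (extChartAt I x x) := by
  have : IsManifold I 2 M := IsManifold.of_le (n := ∞) two_le_infty
  have h : DifferentiableWithinAt ℝ (chartField I x X)
      ((extChartAt I x).symm ⁻¹' univ ∩ range I) (extChartAt I x x) :=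
    (hX.mdifferentiable (by simp) x).mdifferentiableWithinAt
      |>.differentiableWithinAt_mpullbackWithin_vectorField
  rwa [preimage_univ, univ_inter, I.range_eq_univ, differentiableWithinAt_univ] at h

theorem mfderiv_extChartAt_mlieBracket (x : M) :
    mfderiv I 𝓘(ℝ, V) (extChartAt I x) x (VectorField.mlieBracket I X Y x) =
      VectorField.lieBracket ℝ (chartField I x X) (chartField I x Y) (extChartAt I x x) := by
  have hbracket : VectorField.lieBracketWithin ℝ (chartField I x X) (chartField I x Y)
      ((extChartAt I x).symm ⁻¹' univ ∩ range I) (extChartAt I x x) =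
      VectorField.lieBracket ℝ (chartField I x X) (chartField I x Y) (extChartAt I x x) := by
    rw [preimage_univ, univ_inter, I.range_eq_univ, VectorField.lieBracketWithin_univ]
  refine Eq.trans ?_ hbracket
  exact (isInvertible_mfderiv_extChartAt (mem_extChartAt_source x)).self_apply_inverse _

theorem dirDeriv_mlieBracket [CompleteSpace V] (hf : ContMDiff I 𝓘(ℝ, ℝ) ∞ f)
    (hX : ContMDiff I I.tangent ∞ fun x => (⟨x, X x⟩ : TangentBundle I M))
    (hY : ContMDiff I I.tangent ∞ fun x => (⟨x, Y x⟩ : TangentBundle I M)) (x : M) :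
    dirDeriv I f x (VectorField.mlieBracket I X Y x) =
      dirDeriv I (fun y => dirDeriv I f y (Y y)) x (X x) -
        dirDeriv I (fun y => dirDeriv I f y (X y)) x (Y x) := by
  have hx := mem_extChartAt_target (I := I) x
  have htarget : (extChartAt I x).target ∈ 𝓝 (extChartAt I x x) := extChartAt_target_mem_nhds x
  have hfc : ContDiffAt ℝ ∞ (f ∘ (extChartAt I x).symm) (extChartAt I x x) :=
    contMDiffAt_iff_contDiffAt.1 <|
      hf.contMDiffAt.comp _ ((contMDiffOn_extChartAt_symm x).contMDiffAt htarget)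
  have hchart : ∀ Z : ∀ x, TangentSpace I x,
      (fun z => fderiv ℝ (f ∘ (extChartAt I x).symm) z (chartField I x Z z))
        =ᶠ[𝓝 (extChartAt I x x)]
      (fun y => dirDeriv I f y (Z y)) ∘ (extChartAt I x).symm := by
    intro Z
    filter_upwards [htarget] with z hz
    exact fderiv_chartField hz (hf.mdifferentiable (by simp) _)
  have hbracket := VectorField.fderiv_apply_lieBracket hfc (by simpa using two_le_infty)
    (differentiableAt_chartField hY x) (differentiableAt_chartField hX x)
  rw [(hchart X).fderiv_eq, (hchart Y).fderiv_eq,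
    fderiv_chartField hx ((contMDiff_dirDeriv hf hY).mdifferentiable (by simp) _),
    fderiv_chartField hx ((contMDiff_dirDeriv hf hX).mdifferentiable (by simp) _),
    extChartAt_to_inv] at hbracket
  rw [← hbracket, dirDeriv_eq_fderiv_extChartAt (hf.mdifferentiable (by simp) x),
    mfderiv_extChartAt_mlieBracket]

end Smooth

end DirDeriv

theorem contMDiff_comp_mul_of_tsupport {V H M W K P : Type*} [NormedAddCommGroup V]
    [NormedSpace ℝ V] [TopologicalSpace H] {I : ModelWithCorners ℝ V H} [TopologicalSpace M]
    [ChartedSpace H M] [NormedAddCommGroup W] [NormedSpace ℝ W] [TopologicalSpace K]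
    {J : ModelWithCorners ℝ W K} [TopologicalSpace P] [ChartedSpace K P] {pr : P → M}
    (hpr : ContMDiff J I ∞ pr) {χ : M → ℝ} (hχ : ContMDiff I 𝓘(ℝ, ℝ) ∞ χ) {U : Set M}
    (hU : IsOpen U) (hχU : tsupport χ ⊆ U) {g : P → ℝ}
    (hg : ContMDiffOn J 𝓘(ℝ, ℝ) ∞ g (pr ⁻¹' U)) :
    ContMDiff J 𝓘(ℝ, ℝ) ∞ fun p => χ (pr p) * g p := by
  have hsupp : tsupport (fun p => χ (pr p) * g p) ⊆ pr ⁻¹' tsupport χ :=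
    closure_minimal (fun y hy => subset_tsupport _ (left_ne_zero_of_mul hy))
      ((isClosed_tsupport χ).preimage hpr.continuous)
  exact contMDiff_of_tsupport fun p hp => (hχ.comp hpr).contMDiffAt.mul
    (hg.contMDiffAt ((hU.preimage hpr.continuous).mem_nhds (hχU (hsupp hp))))

section Sections

variable {V F Q : Type*} [NormedAddCommGroup V] [NormedSpace ℝ V]
  [NormedAddCommGroup F] [NormedSpace ℝ F] [TopologicalSpace Q] [ChartedSpace V Q]
  {E : Q → Type*} [∀ q, AddCommGroup (E q)] [∀ q, Module ℝ (E q)] [∀ q, TopologicalSpace (E q)]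
  [TopologicalSpace (TotalSpace F E)] [FiberBundle F E]

variable (V) in
theorem exists_smooth_bump [FiniteDimensional ℝ V] [T2Space Q] [IsManifold 𝓘(ℝ, V) ∞ Q]
    {q₀ : Q} {U : Set Q} (hU : U ∈ 𝓝 q₀) :
    ∃ χ : Q → ℝ, ContMDiff 𝓘(ℝ, V) 𝓘(ℝ, ℝ) ∞ χ ∧ tsupport χ ⊆ U ∧ ∀ᶠ q in 𝓝 q₀, χ q = 1 := by
  obtain ⟨χ, hχ, -⟩ := (SmoothBumpFunction.nhds_basis_support (I := 𝓘(ℝ, V)) hU).mem_iff.1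
    (univ_mem : (univ : Set Q) ∈ 𝓝 q₀)
  exact ⟨χ, χ.contMDiff, hχ, χ.eventuallyEq_one⟩

section VectorBundle

variable [VectorBundle ℝ F E] {σ τ : ∀ q, E q} {f : Q → ℝ}

theorem SmoothSection.add (hσ : SmoothSection V F σ) (hτ : SmoothSection V F τ) :
    SmoothSection V F (σ + τ) :=
  ContMDiff.add_section hσ hτ

theorem SmoothSection.neg (hσ : SmoothSection V F σ) : SmoothSection V F (-σ) :=
  ContMDiff.neg_section hσ

theorem SmoothSection.smul (hf : ContMDiff 𝓘(ℝ, V) 𝓘(ℝ, ℝ) ∞ f) (hσ : SmoothSection V F σ) :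
    SmoothSection V F fun q => f q • σ q :=
  ContMDiff.smul_section hf hσ

theorem SmoothSection.sum {ι : Type*} (s : Finset ι) {σ : ι → ∀ q, E q}
    (hσ : ∀ i ∈ s, SmoothSection V F (σ i)) :
    SmoothSection V F fun q => ∑ i ∈ s, σ i q :=
  ContMDiff.sum_section hσ

end VectorBundle

variable (V F E) in
/-- A local frame near `q₀` cut off to global smooth sections `sec k` of `E`, together with its
coordinates, cut off to global smooth functions on the total space. Near `q₀` the frame is the
image of a basis of the model fibre under the trivialization at `q₀`. -/
structure FrameAt [FiniteDimensional ℝ F] (q₀ : Q) where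
  sec : Fin (Module.finrank ℝ F) → ∀ q, E q
  coord : Fin (Module.finrank ℝ F) → ∀ q, E q →ₗ[ℝ] ℝ
  smooth_sec : ∀ k, SmoothSection V F (sec k)
  smooth_coord : ∀ k, ContMDiff (𝓘(ℝ, V).prod 𝓘(ℝ, F)) 𝓘(ℝ, ℝ) ∞
    fun x : TotalSpace F E => coord k x.1 x.2
  sum_coord : ∀ᶠ q in 𝓝 q₀, ∀ a, ∑ k, coord k q a • sec k q = a
  coord_sec : ∀ k l, coord k q₀ (sec l q₀) = if l = k then 1 else 0
  sec_eq : ∀ᶠ q in 𝓝 q₀, ∀ k,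
    sec k q = (trivializationAt F E q₀).symm q (Module.finBasis ℝ F k)

section Trivialization

variable [VectorBundle ℝ F E] (t : Trivialization F (TotalSpace.proj : TotalSpace F E → Q))
  [MemTrivializationAtlas t]

theorem linearMapAt_symm {q : Q} (hq : q ∈ t.baseSet) (y : F) :
    t.linearMapAt ℝ q (t.symm q y) = y := by
  rw [← t.symmₗ_apply (R := ℝ) hq, t.linearMapAt_symmₗ hq]

theorem sum_coord_linearMapAt_smul_symm {ι : Type*} [Fintype ι] (b : Module.Basis ι ℝ F) {q : Q}
    (hq : q ∈ t.baseSet) (a : E q) :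
    ∑ k, b.coord k (t.linearMapAt ℝ q a) • t.symm q (b k) = a := by
  simp only [← t.symmₗ_apply (R := ℝ) hq, ← map_smul, ← map_sum, Module.Basis.coord_apply,
    b.sum_repr, t.symmₗ_linearMapAt hq]

variable [ContMDiffVectorBundle ∞ F E 𝓘(ℝ, V)]

theorem contMDiffOn_symm_const (y : F) :
    ContMDiffOn 𝓘(ℝ, V) (𝓘(ℝ, V).prod 𝓘(ℝ, F)) ∞ (fun q => TotalSpace.mk' F q (t.symm q y))
      t.baseSet := by
  rw [t.contMDiffOn_section_baseSet_iff]
  exact (contMDiffOn_const (c := y)).congr fun q hq =>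
    (congrFun (t.coe_linearMapAt_of_mem (R := ℝ) hq) _).symm.trans (linearMapAt_symm t hq y)

theorem contMDiffOn_coord_linearMapAt [FiniteDimensional ℝ F] (l : F →ₗ[ℝ] ℝ) :
    ContMDiffOn (𝓘(ℝ, V).prod 𝓘(ℝ, F)) 𝓘(ℝ, ℝ) ∞
      (fun x : TotalSpace F E => l (t.linearMapAt ℝ x.1 x.2)) (TotalSpace.proj ⁻¹' t.baseSet) := by
  have hfibre : ContMDiffOn (𝓘(ℝ, V).prod 𝓘(ℝ, F)) 𝓘(ℝ, F) ∞
      (fun x : TotalSpace F E => (t x).2) (TotalSpace.proj ⁻¹' t.baseSet) := by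
    rw [← t.source_eq]
    exact contMDiff_snd.comp_contMDiffOn t.contMDiffOn
  refine (l.toContinuousLinearMap.contDiff.contMDiff.comp_contMDiffOn hfibre).congr
    fun x hx => ?_
  rw [t.coe_linearMapAt_of_mem hx]
  rfl

end Trivialization

variable [FiniteDimensional ℝ V] [FiniteDimensional ℝ F] [T2Space Q] [IsManifold 𝓘(ℝ, V) ∞ Q]
  [VectorBundle ℝ F E] [ContMDiffVectorBundle ∞ F E 𝓘(ℝ, V)]

theorem nonempty_frameAt (q₀ : Q) : Nonempty (FrameAt V F E q₀) := by
  set t := trivializationAt F E q₀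
  set b := Module.finBasis ℝ F
  have hq₀ : q₀ ∈ t.baseSet := mem_baseSet_trivializationAt F E q₀
  obtain ⟨χ, hχ, hχt, hχ₁⟩ := exists_smooth_bump V (t.open_baseSet.mem_nhds hq₀)
  exact ⟨{
    sec := fun k q => χ q • t.symm q (b k)
    coord := fun k q => χ q • b.coord k ∘ₗ t.linearMapAt ℝ q
    smooth_sec := fun k => ContMDiffOn.smul_section_of_tsupport hχ.contMDiffOn t.open_baseSet hχt
      (contMDiffOn_symm_const t (b k))
    smooth_coord := fun k => contMDiff_comp_mul_of_tsupport (contMDiff_proj E) hχ t.open_baseSet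
      hχt (contMDiffOn_coord_linearMapAt t (b.coord k))
    sum_coord := by
      filter_upwards [hχ₁, t.open_baseSet.mem_nhds hq₀] with q hq hqt a
      simpa only [hq, one_smul, LinearMap.comp_apply] using
        sum_coord_linearMapAt_smul_symm t b hqt a
    coord_sec := fun k l => by
      simp [hχ₁.self_of_nhds, linearMapAt_symm t hq₀, Finsupp.single_apply]
    sec_eq := hχ₁.mono fun q hq k => by simp [hq, t, b] }⟩

theorem exists_smoothSection {q₀ : Q} (a : E q₀) :
    ∃ σ : ∀ q, E q, SmoothSection V F σ ∧ σ q₀ = a := by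
  obtain ⟨φ⟩ := nonempty_frameAt (V := V) (F := F) (E := E) q₀
  exact ⟨fun q => ∑ k, φ.coord k q₀ a • φ.sec k q,
    SmoothSection.sum _ fun k _ => ContMDiff.const_smul_section (φ.smooth_sec k),
    φ.sum_coord.self_of_nhds a⟩

end Sections

namespace LieAlgebroid

section Bracket

variable {V F Q : Type*} [NormedAddCommGroup V] [NormedSpace ℝ V]
  [NormedAddCommGroup F] [NormedSpace ℝ F]
  [TopologicalSpace Q] [ChartedSpace V Q] [IsManifold 𝓘(ℝ, V) ∞ Q]
  {E : Q → Type*} [∀ q, AddCommGroup (E q)] [∀ q, Module ℝ (E q)] [∀ q, TopologicalSpace (E q)]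
  [TopologicalSpace (TotalSpace F E)] [FiberBundle F E]
  (𝓔 : LieAlgebroid V F E) {σ τ τ' υ : ∀ q, E q} {f : Q → ℝ}

theorem contMDiff_anchor_section (hσ : SmoothSection V F σ) :
    ContMDiff 𝓘(ℝ, V) 𝓘(ℝ, V).tangent ∞
      fun q => (⟨q, 𝓔.anchor q (σ q)⟩ : TangentBundle 𝓘(ℝ, V) Q) :=
  𝓔.contMDiff_anchor.comp hσ

/-- The derivative `ρ(σ) f` of a function along the anchor of a section. -/
def act (σ : ∀ q, E q) (f : Q → ℝ) (q : Q) : ℝ :=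
  dirDeriv 𝓘(ℝ, V) f q (𝓔.anchor q (σ q))

theorem contMDiff_act (hσ : SmoothSection V F σ) (hf : ContMDiff 𝓘(ℝ, V) 𝓘(ℝ, ℝ) ∞ f) :
    ContMDiff 𝓘(ℝ, V) 𝓘(ℝ, ℝ) ∞ (𝓔.act σ f) :=
  contMDiff_dirDeriv hf (𝓔.contMDiff_anchor_section hσ)

theorem bracket_fun_smul (hf : ContMDiff 𝓘(ℝ, V) 𝓘(ℝ, ℝ) ∞ f) (hσ : SmoothSection V F σ)
    (hτ : SmoothSection V F τ) :
    𝓔.bracket σ (fun q => f q • τ q) =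
      (fun q => f q • 𝓔.bracket σ τ q) + fun q => 𝓔.act σ f q • τ q :=
  funext (𝓔.leibniz f σ τ hf hσ hτ)

theorem bracket_zero (hσ : SmoothSection V F σ) : 𝓔.bracket σ 0 = 0 := by
  simpa using 𝓔.bracket_smul 0 σ σ hσ hσ

theorem bracket_neg (hσ : SmoothSection V F σ) (hτ : SmoothSection V F τ) :
    𝓔.bracket σ (-τ) = -𝓔.bracket σ τ := by
  simpa using 𝓔.bracket_smul (-1) σ τ hσ hτ

section Local

variable [FiniteDimensional ℝ V] [T2Space Q]

theorem bracket_eq_zero_of_eventually (hσ : SmoothSection V F σ) (hτ : SmoothSection V F τ)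
    {q : Q} (h : ∀ᶠ y in 𝓝 q, τ y = 0) : 𝓔.bracket σ τ q = 0 := by
  obtain ⟨χ, hχ, hχτ, hχ₁⟩ := exists_smooth_bump V h
  have hzero : (fun y => χ y • τ y) = 0 := by
    funext y
    by_cases hy : χ y = 0
    · simp [hy]
    · have hτy : τ y = 0 := hχτ (subset_tsupport _ hy)
      simp [hτy]
  have hleibniz := 𝓔.leibniz χ σ τ hχ hσ hτ q
  have hχ₁' : χ =ᶠ[𝓝 q] fun _ => 1 := hχ₁
  rw [hzero, 𝓔.bracket_zero hσ, dirDeriv_congr hχ₁', hχ₁.self_of_nhds] at hleibniz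
  simpa using hleibniz.symm

theorem bracket_congr_right [VectorBundle ℝ F E] (hσ : SmoothSection V F σ)
    (hτ : SmoothSection V F τ) (hτ' : SmoothSection V F τ') {q : Q}
    (h : ∀ᶠ y in 𝓝 q, τ y = τ' y) : 𝓔.bracket σ τ q = 𝓔.bracket σ τ' q := by
  have hdiff : 𝓔.bracket σ (τ + -τ') q = 0 := by
    refine 𝓔.bracket_eq_zero_of_eventually hσ (hτ.add hτ'.neg) ?_
    filter_upwards [h] with y hy
    simp [hy]
  rw [𝓔.bracket_add σ _ _ hσ hτ hτ'.neg, 𝓔.bracket_neg hσ hτ', Pi.add_apply, Pi.neg_apply,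
    ← sub_eq_add_neg] at hdiff
  exact sub_eq_zero.1 hdiff

end Local

theorem bracket_bracket (hσ : SmoothSection V F σ) (hτ : SmoothSection V F τ)
    (hυ : SmoothSection V F υ) :
    𝓔.bracket (𝓔.bracket σ τ) υ =
      𝓔.bracket σ (𝓔.bracket τ υ) - 𝓔.bracket τ (𝓔.bracket σ υ) := by
  have h := 𝓔.jacobi σ τ υ hσ hτ hυ
  rw [𝓔.bracket_antisymm υ σ hυ hσ, 𝓔.bracket_neg hτ (𝓔.smooth_bracket _ _ hσ hυ),
    𝓔.bracket_antisymm υ _ hυ (𝓔.smooth_bracket _ _ hσ hτ)] at h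
  rw [← sub_eq_zero, ← neg_eq_zero, ← h]
  abel

variable [VectorBundle ℝ F E]

theorem bracket_sum_right {ι : Type*} (s : Finset ι) {g : ι → Q → ℝ} {τ : ι → ∀ q, E q}
    (hσ : SmoothSection V F σ) (hg : ∀ i ∈ s, ContMDiff 𝓘(ℝ, V) 𝓘(ℝ, ℝ) ∞ (g i))
    (hτ : ∀ i ∈ s, SmoothSection V F (τ i)) (q : Q) :
    𝓔.bracket σ (fun q => ∑ i ∈ s, g i q • τ i q) q =
      ∑ i ∈ s, (g i q • 𝓔.bracket σ (τ i) q + 𝓔.act σ (g i) q • τ i q) := by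
  classical
  induction s using Finset.induction_on with
  | empty => exact congrFun (𝓔.bracket_zero hσ) q
  | insert a s ha ih =>
    rw [Finset.forall_mem_insert] at hg hτ
    simp only [Finset.sum_insert ha]
    refine (congrFun (𝓔.bracket_add σ _ _ hσ (SmoothSection.smul hg.1 hτ.1) (SmoothSection.sum s
      fun i hi => SmoothSection.smul (hg.2 i hi) (hτ.2 i hi))) q).trans ?_
    rw [Pi.add_apply, 𝓔.leibniz _ _ _ hg.1 hσ hτ.1, ih hg.2 hτ.2]
    rfl

theorem bracket_bracket_fun_smul (hf : ContMDiff 𝓘(ℝ, V) 𝓘(ℝ, ℝ) ∞ f) (hσ : SmoothSection V F σ)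
    (hτ : SmoothSection V F τ) (hυ : SmoothSection V F υ) (q : Q) :
    𝓔.bracket σ (𝓔.bracket τ fun q => f q • υ q) q =
      f q • 𝓔.bracket σ (𝓔.bracket τ υ) q + 𝓔.act σ f q • 𝓔.bracket τ υ q +
        (𝓔.act τ f q • 𝓔.bracket σ υ q + 𝓔.act σ (𝓔.act τ f) q • υ q) := by
  have hτυ := 𝓔.smooth_bracket _ _ hτ hυ
  have hτf := 𝓔.contMDiff_act hτ hf
  rw [𝓔.bracket_fun_smul hf hτ hυ, 𝓔.bracket_add σ _ _ hσ (SmoothSection.smul hf hτυ)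
    (SmoothSection.smul hτf hυ), 𝓔.bracket_fun_smul hf hσ hτυ, 𝓔.bracket_fun_smul hτf hσ hυ]
  rfl

variable [FiniteDimensional ℝ V] [FiniteDimensional ℝ F] [T2Space Q]
  [ContMDiffVectorBundle ∞ F E 𝓘(ℝ, V)]

theorem act_bracket (hf : ContMDiff 𝓘(ℝ, V) 𝓘(ℝ, ℝ) ∞ f) (hσ : SmoothSection V F σ)
    (hτ : SmoothSection V F τ) (q : Q) :
    𝓔.act (𝓔.bracket σ τ) f q = 𝓔.act σ (𝓔.act τ f) q - 𝓔.act τ (𝓔.act σ f) q := by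
  by_cases hE : ∀ a : E q, a = 0
  · simp [act, hE]
  push Not at hE
  obtain ⟨a, ha⟩ := hE
  obtain ⟨υ, hυ, rfl⟩ := exists_smoothSection (V := V) (F := F) a
  -- The Jacobi identity for `σ`, `τ`, `f υ`, minus `f` times the one for `σ`, `τ`, `υ`.
  have hfυ := congrFun (𝓔.bracket_bracket hσ hτ (SmoothSection.smul hf hυ)) q
  have hυ' := congrFun (𝓔.bracket_bracket hσ hτ hυ) q
  rw [𝓔.bracket_fun_smul hf (𝓔.smooth_bracket _ _ hσ hτ) hυ, Pi.add_apply, hυ', Pi.sub_apply,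
    Pi.sub_apply, 𝓔.bracket_bracket_fun_smul hf hσ hτ hυ,
    𝓔.bracket_bracket_fun_smul hf hτ hσ hυ, ← sub_eq_zero] at hfυ
  refine smul_left_injective ℝ ha (sub_eq_zero.1 (Eq.trans ?_ hfυ))
  module

end Bracket

end LieAlgebroid

theorem sum_smul_add_sum_smul_change_of_frame {ι κ M : Type*} [Fintype ι] [Fintype κ]
    [AddCommGroup M] [Module ℝ M] {t t' : ι → M} {e e' : κ → M} {A A' : ι → κ → ℝ}
    (ht : ∀ j, t j = ∑ k, A j k • e k) (ht' : ∀ j, t' j = ∑ k, (A j k • e' k + A' j k • e k))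
    (g g' : ι → ℝ) :
    ∑ j, g j • t' j + ∑ j, g' j • t j =
      ∑ k, (∑ j, g j * A j k) • e' k + ∑ k, (∑ j, (g j * A' j k + A j k * g' j)) • e k := by
  simp only [ht, ht', Finset.smul_sum, Finset.sum_smul, smul_add, add_smul, smul_smul,
    Finset.sum_add_distrib, mul_comm (A _ _) (g' _)]
  rw [Finset.sum_comm (f := fun k j => (g j * A j k) • e' k),
    Finset.sum_comm (f := fun k j => (g j * A' j k) • e k),
    Finset.sum_comm (f := fun k j => (g' j * A j k) • e k), add_assoc]

namespace LieAlgebroid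

section Prolongation

variable {V F Q : Type*} [NormedAddCommGroup V] [NormedSpace ℝ V]
  [NormedAddCommGroup F] [NormedSpace ℝ F]
  [TopologicalSpace Q] [ChartedSpace V Q] [IsManifold 𝓘(ℝ, V) ∞ Q]
  {E : Q → Type*} [∀ q, AddCommGroup (E q)] [∀ q, Module ℝ (E q)] [∀ q, TopologicalSpace (E q)]
  [TopologicalSpace (TotalSpace F E)] [FiberBundle F E]
  (𝓔 : LieAlgebroid V F E)
  {W K P : Type*} [NormedAddCommGroup W] [NormedSpace ℝ W] [TopologicalSpace K]
  {J : ModelWithCorners ℝ W K} [TopologicalSpace P] [ChartedSpace K P]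
  {pr : P → Q} {Z Z₁ Z₂ : ∀ p, 𝓔.Prol J pr p} {p : P}
  {ι κ : Type} [Fintype ι] [Fintype κ] {f : ι → P → ℝ} {σ : ι → ∀ q, E q}
  {g : κ → P → ℝ} {τ : κ → ∀ q, E q}

/-- Near `p` the first component of the section `Z` of the prolongation is `∑ fᵢ (σᵢ ∘ pr)`, with
`σᵢ` smooth sections of `E` and `fᵢ` smooth functions on `P`. -/
structure IsLocalExpansion (Z : ∀ p, 𝓔.Prol J pr p) (p : P) (f : ι → P → ℝ)
    (σ : ι → ∀ q, E q) : Prop where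
  smooth_sec : ∀ i, SmoothSection V F (σ i)
  smooth_coeff : ∀ i, ContMDiff J 𝓘(ℝ, ℝ) ∞ (f i)
  eventually_eq : ∀ᶠ y in 𝓝 p, (Z y).1.1 = ∑ i, f i y • σ i (pr y)

variable (pr) in
/-- The first component of the bracket at `p` of two sections of the prolongation with first
components `∑ fᵢ (σᵢ ∘ pr)` and `∑ gⱼ (τⱼ ∘ pr)` near `p`, and second components `v` and `w` at `p`.
The two families `σ` and `τ` may differ, so that either one can be changed separately. -/
def prolBracketFst (f : ι → P → ℝ) (σ : ι → ∀ q, E q) (g : κ → P → ℝ) (τ : κ → ∀ q, E q)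
    (p : P) (v w : TangentSpace J p) : E (pr p) :=
  ∑ j, g j p • ∑ i, f i p • 𝓔.bracket (σ i) (τ j) (pr p) +
    ∑ j, dirDeriv J (g j) p v • τ j (pr p) - ∑ i, dirDeriv J (f i) p w • σ i (pr p)

theorem prolBracketFst_antisymm (hσ : ∀ i, SmoothSection V F (σ i))
    (hτ : ∀ j, SmoothSection V F (τ j)) (v w : TangentSpace J p) :
    𝓔.prolBracketFst pr f σ g τ p v w = -𝓔.prolBracketFst pr g τ f σ p w v := by
  simp only [prolBracketFst, Finset.smul_sum, fun i j => 𝓔.bracket_antisymm _ _ (hσ i) (hτ j),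
    Pi.neg_apply, smul_neg, Finset.sum_neg_distrib]
  rw [Finset.sum_comm]
  simp only [smul_comm (g _ p)]
  abel

theorem dirDeriv_comp_pr (hpr : MDifferentiableAt J 𝓘(ℝ, V) pr p) {h : Q → ℝ}
    (hh : MDifferentiableAt 𝓘(ℝ, V) 𝓘(ℝ, ℝ) h (pr p)) (z : 𝓔.Prol J pr p) :
    dirDeriv J (fun y => h (pr y)) p z.1.2 =
      dirDeriv 𝓘(ℝ, V) h (pr p) (𝓔.anchor (pr p) z.1.1) :=
  (dirDeriv_comp hh hpr _).trans (congrArg _ z.2.symm)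

variable {𝓔}

namespace IsLocalExpansion

theorem eventually_dirDeriv_comp_pr (hZ : 𝓔.IsLocalExpansion Z p f σ)
    (hpr : ContMDiff J 𝓘(ℝ, V) ∞ pr) {h : Q → ℝ} (hh : ContMDiff 𝓘(ℝ, V) 𝓘(ℝ, ℝ) ∞ h) :
    ∀ᶠ y in 𝓝 p, dirDeriv J (fun x => h (pr x)) y (Z y).1.2 =
      ∑ i, f i y * 𝓔.act (σ i) h (pr y) := by
  filter_upwards [hZ.eventually_eq] with y hy
  rw [𝓔.dirDeriv_comp_pr (hpr.mdifferentiable (by simp) y) (hh.mdifferentiable (by simp) _), hy]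
  simp only [map_sum, map_smul, smul_eq_mul, act]

theorem dirDeriv_sum_mul_comp_pr (hZ : 𝓔.IsLocalExpansion Z p f σ)
    (hpr : ContMDiff J 𝓘(ℝ, V) ∞ pr) (hg : ∀ j, ContMDiff J 𝓘(ℝ, ℝ) ∞ (g j)) {h : κ → Q → ℝ}
    (hh : ∀ j, ContMDiff 𝓘(ℝ, V) 𝓘(ℝ, ℝ) ∞ (h j)) :
    dirDeriv J (fun y => ∑ j, g j y * h j (pr y)) p (Z p).1.2 =
      ∑ j, (g j p * ∑ i, f i p * 𝓔.act (σ i) (h j) (pr p) +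
        h j (pr p) * dirDeriv J (g j) p (Z p).1.2) :=
  (dirDeriv_sum_mul (g := fun j y => h j (pr y)) _
    (fun j _ => (hg j).mdifferentiable (by simp) p)
    (fun j _ => ((hh j).comp hpr).mdifferentiable (by simp) p) _).trans <|
    Finset.sum_congr rfl fun j _ => by
      rw [(hZ.eventually_dirDeriv_comp_pr hpr (hh j)).self_of_nhds]

theorem dirDeriv_dirDeriv_comp_pr (hZ₁ : 𝓔.IsLocalExpansion Z₁ p f σ)
    (hZ₂ : 𝓔.IsLocalExpansion Z₂ p g τ) (hpr : ContMDiff J 𝓘(ℝ, V) ∞ pr) {h : Q → ℝ}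
    (hh : ContMDiff 𝓘(ℝ, V) 𝓘(ℝ, ℝ) ∞ h) :
    dirDeriv J (fun y => dirDeriv J (fun x => h (pr x)) y (Z₂ y).1.2) p (Z₁ p).1.2 =
      ∑ j, (g j p * ∑ i, f i p * 𝓔.act (σ i) (𝓔.act (τ j) h) (pr p) +
        𝓔.act (τ j) h (pr p) * dirDeriv J (g j) p (Z₁ p).1.2) := by
  rw [dirDeriv_congr (hZ₂.eventually_dirDeriv_comp_pr hpr hh),
    hZ₁.dirDeriv_sum_mul_comp_pr hpr hZ₂.smooth_coeff
      fun j => 𝓔.contMDiff_act (hZ₂.smooth_sec j) hh]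

end IsLocalExpansion

variable [FiniteDimensional ℝ F]

/-- The coordinates of the first component of `Z` in a frame of `E`. -/
def frameCoeff {q : Q} (φ : FrameAt V F E q) (Z : ∀ p, 𝓔.Prol J pr p)
    (k : Fin (Module.finrank ℝ F)) (p : P) : ℝ :=
  φ.coord k (pr p) (Z p).1.1

theorem ProlSmooth.isLocalExpansion_frame [IsManifold J ∞ P] (hZ : 𝓔.ProlSmooth Z)
    (hpr : ContinuousAt pr p) (φ : FrameAt V F E (pr p)) :
    𝓔.IsLocalExpansion Z p (frameCoeff φ Z) φ.sec where
  smooth_sec := φ.smooth_sec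
  smooth_coeff k := (φ.smooth_coord k).comp hZ.1
  eventually_eq := (hpr.eventually φ.sum_coord).mono fun _ hy => (hy _).symm

variable [FiniteDimensional ℝ V] [T2Space Q] [VectorBundle ℝ F E]

variable (𝓔) in
theorem bracket_eq_sum_frame {υ υ' : ∀ q, E q} (hυ : SmoothSection V F υ)
    (hυ' : SmoothSection V F υ') {q : Q} (φ : FrameAt V F E q) :
    𝓔.bracket υ υ' q = ∑ k, (φ.coord k q (υ' q) • 𝓔.bracket υ (φ.sec k) q +
      𝓔.act υ (fun x => φ.coord k x (υ' x)) q • φ.sec k q) := by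
  have hcoord : ∀ k, ContMDiff 𝓘(ℝ, V) 𝓘(ℝ, ℝ) ∞ fun x => φ.coord k x (υ' x) :=
    fun k => (φ.smooth_coord k).comp hυ'
  rw [← 𝓔.bracket_sum_right Finset.univ hυ (fun k _ => hcoord k) (fun k _ => φ.smooth_sec k)]
  exact 𝓔.bracket_congr_right hυ hυ'
    (SmoothSection.sum _ fun k _ => SmoothSection.smul (hcoord k) (φ.smooth_sec k))
    (φ.sum_coord.mono fun x hx => (hx _).symm)

namespace IsLocalExpansion

theorem prolBracketFst_eq_frame (hZ₁ : 𝓔.IsLocalExpansion Z₁ p f σ)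
    (hZ₂ : 𝓔.IsLocalExpansion Z₂ p g τ) (hpr : ContMDiff J 𝓘(ℝ, V) ∞ pr)
    (φ : FrameAt V F E (pr p)) (w : TangentSpace J p) :
    𝓔.prolBracketFst pr f σ g τ p (Z₁ p).1.2 w =
      𝓔.prolBracketFst pr f σ (frameCoeff φ Z₂) φ.sec p (Z₁ p).1.2 w := by
  have hA : ∀ j k, ContMDiff 𝓘(ℝ, V) 𝓘(ℝ, ℝ) ∞ fun q => φ.coord k q (τ j q) :=
    fun j k => (φ.smooth_coord k).comp (hZ₂.smooth_sec j)
  have hbracket : ∀ j, ∑ i, f i p • 𝓔.bracket (σ i) (τ j) (pr p) =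
      ∑ k, (φ.coord k (pr p) (τ j (pr p)) • ∑ i, f i p • 𝓔.bracket (σ i) (φ.sec k) (pr p) +
        (∑ i, f i p * 𝓔.act (σ i) (fun q => φ.coord k q (τ j q)) (pr p)) • φ.sec k (pr p)) := by
    intro j
    simp only [fun i => 𝓔.bracket_eq_sum_frame (hZ₁.smooth_sec i) (hZ₂.smooth_sec j) φ,
      Finset.smul_sum, smul_add, Finset.sum_smul, smul_smul, Finset.sum_add_distrib,
      mul_comm (φ.coord _ _ _)]
    rw [Finset.sum_comm, Finset.sum_comm (f := fun i k => (f i p * 𝓔.act _ _ _) • _)]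
  have hcoord : ∀ k, frameCoeff φ Z₂ k =ᶠ[𝓝 p]
      fun y => ∑ j, g j y * φ.coord k (pr y) (τ j (pr y)) := by
    intro k
    filter_upwards [hZ₂.eventually_eq] with y hy
    simp [frameCoeff, hy]
  have hderiv : ∀ k, dirDeriv J (frameCoeff φ Z₂ k) p (Z₁ p).1.2 =
      ∑ j, (g j p * (∑ i, f i p * 𝓔.act (σ i) (fun q => φ.coord k q (τ j q)) (pr p)) +
        φ.coord k (pr p) (τ j (pr p)) * dirDeriv J (g j) p (Z₁ p).1.2) := by
    intro k
    rw [dirDeriv_congr (hcoord k)]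
    exact hZ₁.dirDeriv_sum_mul_comp_pr hpr hZ₂.smooth_coeff fun j => hA j k
  simp only [prolBracketFst, hderiv, fun k => (hcoord k).self_of_nhds]
  rw [sum_smul_add_sum_smul_change_of_frame
    (fun j => (φ.sum_coord.self_of_nhds (τ j (pr p))).symm) hbracket]

theorem prolBracketFst_eq_frame_frame [IsManifold J ∞ P] (hZ₁ : 𝓔.IsLocalExpansion Z₁ p f σ)
    (hZ₂ : 𝓔.IsLocalExpansion Z₂ p g τ) (hpr : ContMDiff J 𝓘(ℝ, V) ∞ pr)
    (hsmooth : 𝓔.ProlSmooth Z₁) (φ : FrameAt V F E (pr p)) :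
    𝓔.prolBracketFst pr f σ g τ p (Z₁ p).1.2 (Z₂ p).1.2 =
      𝓔.prolBracketFst pr (frameCoeff φ Z₁) φ.sec (frameCoeff φ Z₂) φ.sec p
        (Z₁ p).1.2 (Z₂ p).1.2 := by
  have hframe := hsmooth.isLocalExpansion_frame hpr.continuous.continuousAt φ
  rw [𝓔.prolBracketFst_antisymm hZ₁.smooth_sec hZ₂.smooth_sec,
    hZ₂.prolBracketFst_eq_frame hZ₁ hpr φ,
    ← 𝓔.prolBracketFst_antisymm φ.smooth_sec hZ₂.smooth_sec,
    hframe.prolBracketFst_eq_frame hZ₂ hpr φ]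

end IsLocalExpansion

variable [CompleteSpace W] [J.Boundaryless] [IsManifold J ∞ P] [ContMDiffVectorBundle ∞ F E 𝓘(ℝ, V)]

theorem IsLocalExpansion.anchor_prolBracketFst
    (hZ₁ : 𝓔.IsLocalExpansion Z₁ p f σ) (hZ₂ : 𝓔.IsLocalExpansion Z₂ p g τ)
    (hpr : ContMDiff J 𝓘(ℝ, V) ∞ pr)
    (hX₁ : ContMDiff J J.tangent ∞ fun y => (⟨y, (Z₁ y).1.2⟩ : TangentBundle J P))
    (hX₂ : ContMDiff J J.tangent ∞ fun y => (⟨y, (Z₂ y).1.2⟩ : TangentBundle J P)) :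
    𝓔.anchor (pr p) (𝓔.prolBracketFst pr f σ g τ p (Z₁ p).1.2 (Z₂ p).1.2) =
      mfderiv J 𝓘(ℝ, V) pr p
        (VectorField.mlieBracket J (fun y => (Z₁ y).1.2) (fun y => (Z₂ y).1.2) p) := by
  refine eq_of_forall_dirDeriv_eq fun h hh => ?_
  rw [← dirDeriv_comp (hh.mdifferentiable (by simp) _) (hpr.mdifferentiable (by simp) _),
    dirDeriv_mlieBracket (f := fun y => h (pr y)) (hh.comp hpr) hX₁ hX₂,
    hZ₁.dirDeriv_dirDeriv_comp_pr hZ₂ hpr hh, hZ₂.dirDeriv_dirDeriv_comp_pr hZ₁ hpr hh]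
  have hbracket : ∀ i j, dirDeriv 𝓘(ℝ, V) h (pr p) (𝓔.anchor (pr p)
      (𝓔.bracket (σ i) (τ j) (pr p))) = 𝓔.act (σ i) (𝓔.act (τ j) h) (pr p) -
        𝓔.act (τ j) (𝓔.act (σ i) h) (pr p) :=
    fun i j => 𝓔.act_bracket hh (hZ₁.smooth_sec i) (hZ₂.smooth_sec j) (pr p)
  simp only [prolBracketFst, map_add, map_sub, map_sum, map_smul, smul_eq_mul, hbracket, mul_sub,
    Finset.sum_add_distrib, Finset.sum_sub_distrib, Finset.mul_sum, act]
  rw [Finset.sum_comm (f := fun i j => f i p * (g j p * _))]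
  simp only [mul_left_comm (f _ p) (g _ p), mul_comm (dirDeriv J _ _ _)]
  ring

theorem ProlSmooth.isProlBracket_bracket (hZ₁ : 𝓔.ProlSmooth Z₁) (hZ₂ : 𝓔.ProlSmooth Z₂)
    (hpr : ContMDiff J 𝓘(ℝ, V) ∞ pr) (p : P) :
    𝓔.IsProlBracket Z₁ Z₂ p ((𝓔.prolongation J pr).bracket Z₁ Z₂ p) := by
  obtain ⟨φ⟩ := nonempty_frameAt (V := V) (F := F) (E := E) (pr p)
  have hcont := hpr.continuous.continuousAt (x := p)
  refine Classical.epsilon_spec (p := 𝓔.IsProlBracket Z₁ Z₂ p)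
    ⟨⟨(_, _), (hZ₁.isLocalExpansion_frame hcont φ).anchor_prolBracketFst
      (hZ₂.isLocalExpansion_frame hcont φ) hpr hZ₁.2 hZ₂.2⟩, rfl, ?_⟩
  intro r σ f g hσ hf hg hfσ hgσ
  have h₁ : 𝓔.IsLocalExpansion Z₁ p f σ := ⟨hσ, hf, hfσ⟩
  have h₂ : 𝓔.IsLocalExpansion Z₂ p g σ := ⟨hσ, hg, hgσ⟩
  refine (h₁.prolBracketFst_eq_frame_frame h₂ hpr hZ₁ φ).symm.trans ?_
  rw [prolBracketFst]
  simp only [Finset.smul_sum, smul_smul, sub_smul, Finset.sum_sub_distrib]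
  rw [Finset.sum_comm, add_sub_assoc]
  simp only [mul_comm (g _ p)]

end Prolongation

end LieAlgebroid

section Calculus

variable {W K N : Type*} [NormedAddCommGroup W] [NormedSpace ℝ W] [TopologicalSpace K]
  {J : ModelWithCorners ℝ W K} [TopologicalSpace N] [ChartedSpace K N]

theorem mfderiv_continuousLinearMap_comp {W₁ W₂ : Type*} [NormedAddCommGroup W₁]
    [NormedSpace ℝ W₁] [NormedAddCommGroup W₂] [NormedSpace ℝ W₂] (l : W₁ →L[ℝ] W₂) {φ : N → W₁}
    {n : N} (hφ : MDifferentiableAt J 𝓘(ℝ, W₁) φ n) (v : TangentSpace J n) :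
    mfderiv J 𝓘(ℝ, W₂) (fun y => l (φ y)) n v = l (mfderiv J 𝓘(ℝ, W₁) φ n v) := by
  have h := mfderiv_comp n (I'' := 𝓘(ℝ, W₂)) l.mdifferentiableAt hφ
  rw [ContinuousLinearMap.mfderiv_eq] at h
  exact congrArg (fun L => L v) h

theorem trivializationAt_tangentSpace_snd [IsManifold J 1 N] {x₀ x : N}
    (hx : x ∈ (chartAt K x₀).source) (v : TangentSpace J x) :
    (trivializationAt W (TangentSpace J) x₀ ⟨x, v⟩).2 =
      mfderiv J 𝓘(ℝ, W) (extChartAt J x₀) x v := by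
  rw [← TangentBundle.continuousLinearMapAt_trivializationAt hx]
  exact (congrFun ((trivializationAt W (TangentSpace J) x₀).coe_linearMapAt_of_mem (R := ℝ) hx)
    v).symm

end Calculus

section PhaseBase

variable (V F : Type*) {Q : Type*} [NormedAddCommGroup V] [NormedAddCommGroup F]
  [TopologicalSpace Q] [ChartedSpace V Q] (E : Q → Type*) [∀ q, TopologicalSpace (E q)]
  [TopologicalSpace (TotalSpace F E)] [FiberBundle F E]

/-- The domain in `Q` over which the chart of `E* × ℝ` at a point over `q₀` is defined. -/
def phaseBase (q₀ : Q) : Set Q :=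
  (chartAt V q₀).source ∩ (trivializationAt F E q₀).baseSet

variable {V F E}

theorem isOpen_phaseBase (q₀ : Q) : IsOpen (phaseBase V F E q₀) :=
  (chartAt V q₀).open_source.inter (trivializationAt F E q₀).open_baseSet

theorem mem_phaseBase (q₀ : Q) : q₀ ∈ phaseBase V F E q₀ :=
  ⟨mem_chart_source V q₀, mem_baseSet_trivializationAt F E q₀⟩

end PhaseBase

section PhaseSpace

variable {V F Q : Type*} [NormedAddCommGroup V] [NormedSpace ℝ V]
  [NormedAddCommGroup F] [NormedSpace ℝ F]
  [TopologicalSpace Q] [ChartedSpace V Q]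
  {E : Q → Type*} [∀ q, AddCommGroup (E q)] [∀ q, Module ℝ (E q)] [∀ q, TopologicalSpace (E q)]
  [TopologicalSpace (TotalSpace F E)] [FiberBundle F E] [VectorBundle ℝ F E]

/-- The linear form `b` on the fibre of `E` carried by the point `(b, s)` of `E* × ℝ`. It is typed
with values in `ℝ`, not in the fibre `Bundle.Trivial Q ℝ q` of the trivial bundle. -/
def fibreForm (p : PhaseSpace F E) : E (phaseProj F E p) →ₗ[ℝ] ℝ :=
  p.1.2.toLinearMap

/-- The momentum function `(b, s) ↦ b(σ)` of a section `σ` of `E`. -/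
def momentum (σ : ∀ q, E q) (p : PhaseSpace F E) : ℝ :=
  fibreForm p (σ (phaseProj F E p))

theorem extChartAt_phaseSpace_apply (p₀ p : PhaseSpace F E) :
    extChartAt (phaseModel V F) p₀ p =
      ((extChartAt 𝓘(ℝ, V) (phaseProj F E p₀) (phaseProj F E p),
        (trivializationAt (F →L[ℝ] ℝ) (fun q : Q => E q →L[ℝ] Bundle.Trivial Q ℝ q)
          (phaseProj F E p₀) p.1).2), p.2) := by
  rw [extChartAt_prod, FiberBundle.extChartAt]
  rfl

theorem mem_chartAt_phaseSpace_source {p₀ p : PhaseSpace F E} :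
    p ∈ (chartAt (ModelProd (ModelProd V (F →L[ℝ] ℝ)) ℝ) p₀).source ↔
      phaseProj F E p ∈ phaseBase V F E (phaseProj F E p₀) := by
  rw [← extChartAt_source (phaseModel V F), extChartAt_prod, PartialEquiv.prod_source,
    FiberBundle.extChartAt]
  simp only [PartialEquiv.trans_source, PartialEquiv.prod_source, mfld_simps, phaseBase, phaseProj]
  tauto

theorem momentum_eq_extChartAt {p₀ p : PhaseSpace F E}
    (hp : phaseProj F E p ∈ phaseBase V F E (phaseProj F E p₀)) {σ : ∀ q, E q} {y : F}
    (hσ : σ (phaseProj F E p) =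
      (trivializationAt F E (phaseProj F E p₀)).symm (phaseProj F E p) y) :
    momentum σ p = (extChartAt (phaseModel V F) p₀ p).1.2 y := by
  have hsymm : σ (phaseProj F E p) =
      (trivializationAt F E (phaseProj F E p₀)).symmL ℝ (phaseProj F E p) y :=
    hσ.trans (Trivialization.symmL_apply _ hp.2 _).symm
  refine (congrArg p.1.2 hsymm).trans ?_
  rw [extChartAt_phaseSpace_apply]
  change _ = ContinuousLinearMap.inCoordinates F E ℝ (Bundle.Trivial Q ℝ) (phaseProj F E p₀)
    p.1.proj (phaseProj F E p₀) p.1.proj p.1.2 y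
  rw [ContinuousLinearMap.inCoordinates]
  simp only [Trivial.fiberBundle_trivializationAt', Trivial.continuousLinearMapAt_trivialization,
    ContinuousLinearMap.id_comp, ContinuousLinearMap.comp_apply]
  rfl

theorem contMDiff_phaseProj : ContMDiff (phaseModel V F) 𝓘(ℝ, V) ∞ (phaseProj F E) :=
  (contMDiff_proj (F := F →L[ℝ] ℝ) (IB := 𝓘(ℝ, V))
    fun q : Q => E q →L[ℝ] Bundle.Trivial Q ℝ q).comp contMDiff_fst

theorem contMDiff_fibreForm {a : ∀ p : PhaseSpace F E, E (phaseProj F E p)}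
    (ha : ContMDiff (phaseModel V F) (𝓘(ℝ, V).prod 𝓘(ℝ, F)) ∞
      fun p => TotalSpace.mk' F (phaseProj F E p) (a p)) :
    ContMDiff (phaseModel V F) 𝓘(ℝ, ℝ) ∞ fun p => fibreForm p (a p) := by
  have h : ContMDiff (phaseModel V F) (𝓘(ℝ, V).prod 𝓘(ℝ, ℝ)) ∞ fun p : PhaseSpace F E =>
      TotalSpace.mk' ℝ (E := Bundle.Trivial Q ℝ) (phaseProj F E p) (p.1.2 (a p)) :=
    ContMDiff.clm_bundle_apply (F₁ := F) (F₂ := ℝ) (E₁ := E) (E₂ := Bundle.Trivial Q ℝ)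
      (b := phaseProj F E) (ϕ := fun p => p.1.2) contMDiff_fst ha
  exact fun p => (contMDiffAt_totalSpace.1 (h p)).2

theorem contMDiff_momentum {σ : ∀ q, E q} (hσ : SmoothSection V F σ) :
    ContMDiff (phaseModel V F) 𝓘(ℝ, ℝ) ∞ (momentum (F := F) σ) :=
  contMDiff_fibreForm (a := fun p => σ (phaseProj F E p)) (hσ.comp contMDiff_phaseProj)

/-- The tangent map at `p` of the chart of `E* × ℝ` at `p₀`. -/
def phaseCoord (p₀ p : PhaseSpace F E) :
    TangentSpace (phaseModel V F) p →L[ℝ] (V × (F →L[ℝ] ℝ)) × ℝ :=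
  mfderiv (phaseModel V F) 𝓘(ℝ, (V × (F →L[ℝ] ℝ)) × ℝ) (extChartAt (phaseModel V F) p₀) p

variable [IsManifold 𝓘(ℝ, V) ∞ Q] [ContMDiffVectorBundle ∞ F E 𝓘(ℝ, V)] {p₀ p : PhaseSpace F E}
  {Y : ∀ q : Q, TangentSpace 𝓘(ℝ, V) q}

variable (V) in
/-- The vector field on `E* × ℝ` near `p₀` whose coordinates in the chart at `p₀` are those of the
vector field `Y` on `Q`, together with the constants `β` and `r`. -/
def phaseField (p₀ : PhaseSpace F E) (Y : ∀ q : Q, TangentSpace 𝓘(ℝ, V) q) (β : F →L[ℝ] ℝ) (r : ℝ)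
    (p : PhaseSpace F E) : TangentSpace (phaseModel V F) p :=
  (trivializationAt ((V × (F →L[ℝ] ℝ)) × ℝ) (TangentSpace (phaseModel V F)) p₀).symm p
    (((trivializationAt V (TangentSpace 𝓘(ℝ, V)) (phaseProj F E p₀)
      ⟨phaseProj F E p, Y (phaseProj F E p)⟩).2, β), r)

theorem mdifferentiableAt_extChartAt_phaseSpace
    (hp : phaseProj F E p ∈ phaseBase V F E (phaseProj F E p₀)) :
    MDifferentiableAt (phaseModel V F) 𝓘(ℝ, (V × (F →L[ℝ] ℝ)) × ℝ)
      (extChartAt (phaseModel V F) p₀) p :=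
  have : IsManifold (phaseModel V F) 1 (PhaseSpace F E) := IsManifold.of_le (n := ∞) (by simp)
  mdifferentiableAt_extChartAt (mem_chartAt_phaseSpace_source.2 hp)

theorem phaseCoord_bijective (p : PhaseSpace F E) :
    Function.Bijective (phaseCoord (V := V) p p) :=
  have : IsManifold (phaseModel V F) 1 (PhaseSpace F E) := IsManifold.of_le (n := ∞) (by simp)
  (isInvertible_mfderiv_extChartAt (mem_extChartAt_source p)).bijective

theorem phaseCoord_base (hp : phaseProj F E p ∈ phaseBase V F E (phaseProj F E p₀))
    (v : TangentSpace (phaseModel V F) p) :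
    (phaseCoord p₀ p v).1.1 =
      mfderiv 𝓘(ℝ, V) 𝓘(ℝ, V) (extChartAt 𝓘(ℝ, V) (phaseProj F E p₀)) (phaseProj F E p)
        (mfderiv (phaseModel V F) 𝓘(ℝ, V) (phaseProj F E) p v) := by
  have : IsManifold 𝓘(ℝ, V) 1 Q := IsManifold.of_le (n := ∞) (by simp)
  have hfst := mfderiv_continuousLinearMap_comp
    (ContinuousLinearMap.fst ℝ V (F →L[ℝ] ℝ) ∘L ContinuousLinearMap.fst ℝ (V × (F →L[ℝ] ℝ)) ℝ)
    (mdifferentiableAt_extChartAt_phaseSpace hp) v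
  have hcomp := mfderiv_comp p
    (mdifferentiableAt_extChartAt (I := 𝓘(ℝ, V)) (x := phaseProj F E p₀) hp.1)
    ((contMDiff_phaseProj (E := E)).mdifferentiable (by simp) p)
  have hchart : (fun y => (extChartAt (phaseModel V F) p₀ y).1.1) =
      extChartAt 𝓘(ℝ, V) (phaseProj F E p₀) ∘ phaseProj F E := by
    funext y
    rw [extChartAt_phaseSpace_apply]
    rfl
  refine hfst.symm.trans ?_
  refine (congrArg (fun f => mfderiv (phaseModel V F) 𝓘(ℝ, V) f p v) hchart).trans ?_
  exact congrArg (fun L => L v) hcomp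

theorem phaseCoord_snd (v : TangentSpace (phaseModel V F) p) :
    (phaseCoord p p v).2 = dirDeriv (phaseModel V F) (Prod.snd : PhaseSpace F E → ℝ) p v := by
  have hsnd := mfderiv_continuousLinearMap_comp (ContinuousLinearMap.snd ℝ (V × (F →L[ℝ] ℝ)) ℝ)
    (mdifferentiableAt_extChartAt_phaseSpace (mem_phaseBase (phaseProj F E p))) v
  have hchart : (fun y => (extChartAt (phaseModel V F) p y).2) = Prod.snd := by
    funext y
    rw [extChartAt_phaseSpace_apply]
  exact hsnd.symm.trans (congrArg (fun f => mfderiv (phaseModel V F) 𝓘(ℝ, ℝ) f p v) hchart)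

theorem phaseCoord_fibre [FiniteDimensional ℝ F] (φ : FrameAt V F E (phaseProj F E p))
    (k : Fin (Module.finrank ℝ F)) (v : TangentSpace (phaseModel V F) p) :
    (phaseCoord p p v).1.2 (Module.finBasis ℝ F k) =
      dirDeriv (phaseModel V F) (momentum (φ.sec k)) p v := by
  set l := ContinuousLinearMap.apply ℝ ℝ (Module.finBasis ℝ F k) ∘L
    ContinuousLinearMap.snd ℝ V (F →L[ℝ] ℝ) ∘L ContinuousLinearMap.fst ℝ (V × (F →L[ℝ] ℝ)) ℝ
  have hbase : phaseBase V F E (phaseProj F E p) ∈ 𝓝 (phaseProj F E p) :=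
    (isOpen_phaseBase _).mem_nhds (mem_phaseBase _)
  have hchart : momentum (φ.sec k) =ᶠ[𝓝 p] fun y => l (extChartAt (phaseModel V F) p y) := by
    filter_upwards [(contMDiff_phaseProj (V := V) (E := E)).continuous.continuousAt.eventually
      (φ.sec_eq.and hbase)] with y hy
    exact momentum_eq_extChartAt hy.2 (hy.1 k)
  rw [dirDeriv_congr hchart]
  exact (mfderiv_continuousLinearMap_comp l
    (mdifferentiableAt_extChartAt_phaseSpace (mem_phaseBase (phaseProj F E p))) v).symm

theorem phaseCoord_phaseField (hp : phaseProj F E p ∈ phaseBase V F E (phaseProj F E p₀))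
    (β : F →L[ℝ] ℝ) (r : ℝ) :
    phaseCoord p₀ p (phaseField V p₀ Y β r p) =
      ((mfderiv 𝓘(ℝ, V) 𝓘(ℝ, V) (extChartAt 𝓘(ℝ, V) (phaseProj F E p₀)) (phaseProj F E p)
        (Y (phaseProj F E p)), β), r) := by
  have : IsManifold (phaseModel V F) 1 (PhaseSpace F E) := IsManifold.of_le (n := ∞) (by simp)
  have : IsManifold 𝓘(ℝ, V) 1 Q := IsManifold.of_le (n := ∞) (by simp)
  have hp' := mem_chartAt_phaseSpace_source.2 hp
  rw [← trivializationAt_tangentSpace_snd (J := 𝓘(ℝ, V)) hp.1]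
  refine (trivializationAt_tangentSpace_snd hp' _).symm.trans ?_
  exact congrArg Prod.snd ((trivializationAt ((V × (F →L[ℝ] ℝ)) × ℝ)
    (TangentSpace (phaseModel V F)) p₀).apply_mk_symm hp' _)

theorem mfderiv_phaseProj_phaseField
    (hp : phaseProj F E p ∈ phaseBase V F E (phaseProj F E p₀)) (β : F →L[ℝ] ℝ) (r : ℝ) :
    mfderiv (phaseModel V F) 𝓘(ℝ, V) (phaseProj F E) p (phaseField V p₀ Y β r p) =
      Y (phaseProj F E p) := by
  apply mfderiv_extChartAt_injective (I := 𝓘(ℝ, V)) (x₀ := phaseProj F E p₀)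
    (by simpa only [extChartAt_source] using hp.1)
  rw [← phaseCoord_base hp, phaseCoord_phaseField hp]

theorem contMDiffOn_phaseField (p₀ : PhaseSpace F E)
    (hY : ContMDiff 𝓘(ℝ, V) 𝓘(ℝ, V).tangent ∞ fun q => (⟨q, Y q⟩ : TangentBundle 𝓘(ℝ, V) Q))
    (β : F →L[ℝ] ℝ) (r : ℝ) :
    ContMDiffOn (phaseModel V F) (phaseModel V F).tangent ∞
      (fun p => (⟨p, phaseField V p₀ Y β r p⟩ : TangentBundle (phaseModel V F) (PhaseSpace F E)))
      (phaseProj F E ⁻¹' phaseBase V F E (phaseProj F E p₀)) := by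
  set t := trivializationAt ((V × (F →L[ℝ] ℝ)) × ℝ) (TangentSpace (phaseModel V F)) p₀
  set tQ := trivializationAt V (TangentSpace 𝓘(ℝ, V)) (phaseProj F E p₀)
  have hpr := contMDiff_phaseProj (V := V) (F := F) (E := E)
  rw [t.contMDiffOn_section_iff ((isOpen_phaseBase _).preimage hpr.continuous)
    fun p hp => mem_chartAt_phaseSpace_source.2 hp]
  have hbase : ContMDiffOn (phaseModel V F) 𝓘(ℝ, V) ∞
      (fun p : PhaseSpace F E => (tQ ⟨phaseProj F E p, Y (phaseProj F E p)⟩).2)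
      (phaseProj F E ⁻¹' phaseBase V F E (phaseProj F E p₀)) :=
    (contMDiff_snd.comp_contMDiffOn tQ.contMDiffOn).comp (hY.comp hpr).contMDiffOn
      fun p hp => tQ.mem_source.2 hp.1
  exact ((hbase.prodMk_space contMDiffOn_const).prodMk_space contMDiffOn_const).congr
    fun p hp => congrArg Prod.snd (t.apply_mk_symm (mem_chartAt_phaseSpace_source.2 hp) _)

variable [FiniteDimensional ℝ V] [FiniteDimensional ℝ F] [T2Space Q] (𝓔 : LieAlgebroid V F E)

theorem LieAlgebroid.exists_prolSmooth (z : 𝓔.Prol (phaseModel V F) (phaseProj F E) p₀) :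
    ∃ Z : ∀ p, 𝓔.Prol (phaseModel V F) (phaseProj F E) p, 𝓔.ProlSmooth Z ∧ Z p₀ = z := by
  obtain ⟨σ, hσ, hσz⟩ := exists_smoothSection (V := V) (F := F) z.1.1
  obtain ⟨χ, hχ, hsupp, hχ₁⟩ := exists_smooth_bump V
    ((isOpen_phaseBase (V := V) (F := F) (E := E) _).mem_nhds (mem_phaseBase (phaseProj F E p₀)))
  have hpr := contMDiff_phaseProj (V := V) (F := F) (E := E)
  set X := phaseField V p₀ (fun q => 𝓔.anchor q (σ q)) (phaseCoord p₀ p₀ z.1.2).1.2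
    (phaseCoord p₀ p₀ z.1.2).2 with hX
  have hXz : X p₀ = z.1.2 := by
    apply (phaseCoord_bijective p₀).injective
    rw [hX, phaseCoord_phaseField (mem_phaseBase _), hσz]
    refine Prod.ext (Prod.ext ?_ rfl) rfl
    rw [phaseCoord_base (mem_phaseBase _)]
    exact congrArg _ z.2
  have hmem : ∀ p, 𝓔.anchor _ (χ (phaseProj F E p) • σ (phaseProj F E p)) =
      mfderiv (phaseModel V F) 𝓘(ℝ, V) (phaseProj F E) p (χ (phaseProj F E p) • X p) := by
    intro p
    refine ((𝓔.anchor _).map_smul _ _).trans (Eq.trans ?_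
      ((mfderiv (phaseModel V F) 𝓘(ℝ, V) (phaseProj F E) p).map_smul _ _).symm)
    by_cases hχp : χ (phaseProj F E p) = 0
    · rw [hχp, zero_smul, zero_smul]
    · rw [hX, mfderiv_phaseProj_phaseField (hsupp (subset_tsupport _ hχp))]
  refine ⟨fun p => ⟨(χ (phaseProj F E p) • σ (phaseProj F E p), χ (phaseProj F E p) • X p),
    hmem p⟩, ⟨(SmoothSection.smul hχ hσ).comp hpr, ?_⟩, Subtype.ext (Prod.ext ?_ ?_)⟩
  · exact ContMDiffOn.smul_section_of_tsupport (ψ := fun p => χ (phaseProj F E p))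
      (hχ.comp hpr).contMDiffOn ((isOpen_phaseBase _).preimage hpr.continuous)
      ((tsupport_comp_subset_preimage χ hpr.continuous).trans (preimage_mono hsupp))
      (contMDiffOn_phaseField p₀ (𝓔.contMDiff_anchor_section hσ) _ _)
  · simp only [hχ₁.self_of_nhds, one_smul, hσz]
  · simp only [hχ₁.self_of_nhds, one_smul, hXz]

end PhaseSpace

theorem exists_eq_of_contact {K X : Type*} [Field K] [AddCommGroup X] [Module K X]
    [FiniteDimensional K X] {η : Module.Dual K X} {Ω : LinearMap.BilinForm K X} {R : X}
    (hΩ : Ω.IsRefl) (hR : Ω R = 0) (hηR : η R = 1)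
    (hnondeg : ∀ z, η z = 0 → Ω z = 0 → z = 0) (s : K) {Λ : Module.Dual K X} (hΛ : Λ R = 0) :
    ∃ ξ, η ξ = s ∧ Ω ξ = Λ := by
  have hΩR : ∀ z, Ω z R = 0 := fun z => hΩ.eq_zero (LinearMap.congr_fun hR z)
  set flat : X →ₗ[K] Module.Dual K X := Ω + η.smulRight η
  have hflatR : ∀ z, flat z R = η z := fun z => by simp [flat, hΩR, hηR]
  have hinj : Function.Injective flat := by
    refine (injective_iff_map_eq_zero flat).2 fun z hz => ?_
    have hηz : η z = 0 := by rw [← hflatR, hz, LinearMap.zero_apply]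
    exact hnondeg z hηz (by simpa [flat, hηz] using hz)
  obtain ⟨ξ, hξ⟩ := (LinearMap.injective_iff_surjective_of_finrank_eq_finrank
    Subspace.dual_finrank_eq.symm).1 hinj (Λ + s • η)
  have hηξ : η ξ = s := by rw [← hflatR, hξ]; simp [hΛ, hηR]
  exact ⟨ξ, hηξ, by simpa [flat, hηξ] using hξ⟩

namespace AlgebroidData

variable {V H M : Type*} [NormedAddCommGroup V] [NormedSpace ℝ V] [TopologicalSpace H]
  {I : ModelWithCorners ℝ V H} [TopologicalSpace M] [ChartedSpace H M]
  {A : M → Type*} [∀ x, AddCommGroup (A x)] [∀ x, Module ℝ (A x)]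
  (𝒜 : AlgebroidData I A)

theorem evalD_oneForm (η : ∀ x, A x →ₗ[ℝ] ℝ) (σ τ : ∀ x, A x) (x : M) :
    𝒜.evalD (oneForm η) ![σ, τ] x =
      𝒜.dFun (fun y => η y (τ y)) x (σ x) - 𝒜.dFun (fun y => η y (σ y)) x (τ x) -
        η x (𝒜.bracket σ τ x) := by
  simp [evalD, oneForm, Fin.sum_univ_succ, sub_eq_add_neg]

theorem dOne_eq_evalD (η : ∀ x, A x →ₗ[ℝ] ℝ) (x : M) (a b : A x) :
    𝒜.dOne η x a b = 𝒜.evalD (oneForm η) ![𝒜.extend x a, 𝒜.extend x b] x := by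
  have hextend : (fun i => 𝒜.extend x ((![a, b] : Fin 2 → A x) i)) =
      ![𝒜.extend x a, 𝒜.extend x b] := by
    funext i
    fin_cases i <;> rfl
  rw [dOne, extDeriv, hextend]

theorem exists_dOne_eq (η : ∀ x, A x →ₗ[ℝ] ℝ) {x : M} {a b : A x}
    (ha : ∃ σ : ∀ y, A y, 𝒜.IsSmooth σ ∧ σ x = a) (hb : ∃ σ : ∀ y, A y, 𝒜.IsSmooth σ ∧ σ x = b) :
    ∃ σ τ : ∀ y, A y, 𝒜.IsSmooth σ ∧ 𝒜.IsSmooth τ ∧ σ x = a ∧ τ x = b ∧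
      𝒜.dOne η x a b = 𝒜.dFun (fun y => η y (τ y)) x (σ x) -
        𝒜.dFun (fun y => η y (σ y)) x (τ x) - η x (𝒜.bracket σ τ x) := by
  obtain ⟨hσ, hσa⟩ := Classical.epsilon_spec ha
  obtain ⟨hτ, hτb⟩ := Classical.epsilon_spec hb
  exact ⟨_, _, hσ, hτ, hσa, hτb, by rw [dOne_eq_evalD, evalD_oneForm]; rfl⟩

end AlgebroidData

section Contact

variable {V F Q : Type*} [NormedAddCommGroup V] [NormedSpace ℝ V]
  [NormedAddCommGroup F] [NormedSpace ℝ F]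
  [TopologicalSpace Q] [ChartedSpace V Q] [IsManifold 𝓘(ℝ, V) ∞ Q]
  {E : Q → Type*} [∀ q, AddCommGroup (E q)] [∀ q, Module ℝ (E q)] [∀ q, TopologicalSpace (E q)]
  [TopologicalSpace (TotalSpace F E)] [FiberBundle F E] [VectorBundle ℝ F E]
  {p : PhaseSpace F E}

namespace LieAlgebroid

variable (𝓔 : LieAlgebroid V F E)

theorem contactForm_apply (z : 𝓔.Prol (phaseModel V F) (phaseProj F E) p) :
    𝓔.contactForm p z =
      dirDeriv (phaseModel V F) (Prod.snd : PhaseSpace F E → ℝ) p z.1.2 - fibreForm p z.1.1 :=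
  rfl

theorem finiteDimensional_prol [FiniteDimensional ℝ V] [FiniteDimensional ℝ F]
    (p : PhaseSpace F E) : FiniteDimensional ℝ (𝓔.Prol (phaseModel V F) (phaseProj F E) p) := by
  have : FiniteDimensional ℝ (E (phaseProj F E p)) :=
    ((trivializationAt F E _).continuousLinearEquivAt ℝ _
      (mem_baseSet_trivializationAt F E _)).symm.toLinearEquiv.finiteDimensional
  have : FiniteDimensional ℝ (TangentSpace (phaseModel V F) p) :=
    inferInstanceAs (FiniteDimensional ℝ ((V × (F →L[ℝ] ℝ)) × ℝ))
  infer_instance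

variable [ContMDiffVectorBundle ∞ F E 𝓘(ℝ, V)]

section Expansion

variable {𝓔} {Z Z₁ Z₂ : ∀ p, 𝓔.Prol (phaseModel V F) (phaseProj F E) p} {r : ℕ}
  {f g : Fin r → PhaseSpace F E → ℝ} {σ : Fin r → ∀ q, E q}

theorem IsLocalExpansion.dirDeriv_contactForm (hexp : 𝓔.IsLocalExpansion Z p f σ)
    (hZ : 𝓔.ProlSmooth Z) (v : TangentSpace (phaseModel V F) p) :
    dirDeriv (phaseModel V F) (fun y => 𝓔.contactForm y (Z y)) p v =
      dirDeriv (phaseModel V F)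
        (fun y => dirDeriv (phaseModel V F) (Prod.snd : PhaseSpace F E → ℝ) y (Z y).1.2) p v -
      ∑ i, (f i p * dirDeriv (phaseModel V F) (momentum (σ i)) p v +
        momentum (σ i) p * dirDeriv (phaseModel V F) (f i) p v) := by
  have hη : (fun y => 𝓔.contactForm y (Z y)) =ᶠ[𝓝 p] fun y =>
      dirDeriv (phaseModel V F) (Prod.snd : PhaseSpace F E → ℝ) y (Z y).1.2 -
        ∑ i, f i y * momentum (σ i) y := by
    filter_upwards [hexp.eventually_eq] with y hy
    rw [contactForm_apply, hy, map_sum]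
    simp only [map_smul, smul_eq_mul, momentum]
  have hf := fun i => (hexp.smooth_coeff i).mdifferentiable (by simp) p
  have hσ := fun i => (contMDiff_momentum (hexp.smooth_sec i)).mdifferentiable (by simp) p
  have hs := (contMDiff_dirDeriv contMDiff_snd hZ.2).mdifferentiable (by simp) p
  have hsum : ContMDiff (phaseModel V F) 𝓘(ℝ, ℝ) ∞ fun y => ∑ i, f i y * momentum (σ i) y :=
    contMDiff_finsetSum fun i _ =>
      (hexp.smooth_coeff i).mul (contMDiff_momentum (hexp.smooth_sec i))
  rw [dirDeriv_congr hη, dirDeriv_sub hs (hsum.mdifferentiable (by simp) p),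
    dirDeriv_sum_mul _ (fun i _ => hf i) (fun i _ => hσ i)]

theorem IsLocalExpansion.contactForm_bracket [FiniteDimensional ℝ V] [FiniteDimensional ℝ F]
    [T2Space Q] (hexp₁ : 𝓔.IsLocalExpansion Z₁ p f σ) (hexp₂ : 𝓔.IsLocalExpansion Z₂ p g σ)
    (hZ₁ : 𝓔.ProlSmooth Z₁) (hZ₂ : 𝓔.ProlSmooth Z₂) :
    𝓔.contactForm p (𝓔.contactProl.bracket Z₁ Z₂ p) =
      dirDeriv (phaseModel V F) (fun y => dirDeriv (phaseModel V F)
        (Prod.snd : PhaseSpace F E → ℝ) y (Z₂ y).1.2) p (Z₁ p).1.2 -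
      dirDeriv (phaseModel V F) (fun y => dirDeriv (phaseModel V F)
        (Prod.snd : PhaseSpace F E → ℝ) y (Z₁ y).1.2) p (Z₂ p).1.2 -
      (∑ i, ∑ j, f i p * g j p * momentum (𝓔.bracket (σ i) (σ j)) p +
        ∑ i, (dirDeriv (phaseModel V F) (g i) p (Z₁ p).1.2 -
          dirDeriv (phaseModel V F) (f i) p (Z₂ p).1.2) * momentum (σ i) p) := by
  obtain ⟨hsnd, hfst⟩ := hZ₁.isProlBracket_bracket hZ₂ contMDiff_phaseProj p
  rw [contactForm_apply, hsnd, dirDeriv_mlieBracket contMDiff_snd hZ₁.2 hZ₂.2,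
    hfst r σ f g hexp₁.smooth_sec hexp₁.smooth_coeff hexp₂.smooth_coeff hexp₁.eventually_eq
      hexp₂.eventually_eq]
  simp only [map_add, map_sum, map_smul, smul_eq_mul, momentum]

theorem IsLocalExpansion.dirDeriv_contactForm_sub_bracket [FiniteDimensional ℝ V]
    [FiniteDimensional ℝ F] [T2Space Q] (hexp₁ : 𝓔.IsLocalExpansion Z₁ p f σ)
    (hexp₂ : 𝓔.IsLocalExpansion Z₂ p g σ) (hZ₁ : 𝓔.ProlSmooth Z₁) (hZ₂ : 𝓔.ProlSmooth Z₂) :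
    dirDeriv (phaseModel V F) (fun y => 𝓔.contactForm y (Z₂ y)) p (Z₁ p).1.2 -
      dirDeriv (phaseModel V F) (fun y => 𝓔.contactForm y (Z₁ y)) p (Z₂ p).1.2 -
      𝓔.contactForm p (𝓔.contactProl.bracket Z₁ Z₂ p) =
      ∑ i, f i p * dirDeriv (phaseModel V F) (momentum (σ i)) p (Z₂ p).1.2 -
      ∑ i, g i p * dirDeriv (phaseModel V F) (momentum (σ i)) p (Z₁ p).1.2 +
      ∑ i, ∑ j, f i p * g j p * momentum (𝓔.bracket (σ i) (σ j)) p := by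
  rw [hexp₁.dirDeriv_contactForm hZ₁, hexp₂.dirDeriv_contactForm hZ₂,
    hexp₁.contactForm_bracket hexp₂ hZ₁ hZ₂]
  simp only [sub_mul, Finset.sum_add_distrib, Finset.sum_sub_distrib, mul_comm (momentum _ p)]
  ring

end Expansion

variable [FiniteDimensional ℝ F]

variable {𝓔} in
theorem prol_ext (φ : FrameAt V F E (phaseProj F E p))
    {z z' : 𝓔.Prol (phaseModel V F) (phaseProj F E) p} (hfst : z.1.1 = z'.1.1)
    (hmomentum : ∀ k, dirDeriv (phaseModel V F) (momentum (φ.sec k)) p z.1.2 =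
      dirDeriv (phaseModel V F) (momentum (φ.sec k)) p z'.1.2)
    (hsnd : dirDeriv (phaseModel V F) (Prod.snd : PhaseSpace F E → ℝ) p z.1.2 =
      dirDeriv (phaseModel V F) (Prod.snd : PhaseSpace F E → ℝ) p z'.1.2) : z = z' := by
  refine Subtype.ext (Prod.ext hfst ((phaseCoord_bijective p).injective ?_))
  refine Prod.ext (Prod.ext ?_ ?_) ?_
  · rw [phaseCoord_base (mem_phaseBase _), phaseCoord_base (mem_phaseBase _)]
    exact congrArg _ (z.2.symm.trans ((congrArg (𝓔.anchor _) hfst).trans z'.2))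
  · refine ContinuousLinearMap.coe_injective ((Module.finBasis ℝ F).ext fun k => ?_)
    exact (phaseCoord_fibre φ k _).trans ((hmomentum k).trans (phaseCoord_fibre φ k _).symm)
  · rwa [phaseCoord_snd, phaseCoord_snd]

theorem exists_prol (φ : FrameAt V F E (phaseProj F E p)) (a : E (phaseProj F E p))
    (β : Fin (Module.finrank ℝ F) → ℝ) (s : ℝ) :
    ∃ z : 𝓔.Prol (phaseModel V F) (phaseProj F E) p, z.1.1 = a ∧
      (∀ k, dirDeriv (phaseModel V F) (momentum (φ.sec k)) p z.1.2 = β k) ∧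
      dirDeriv (phaseModel V F) (Prod.snd : PhaseSpace F E → ℝ) p z.1.2 = s := by
  obtain ⟨v, hv⟩ := (phaseCoord_bijective (V := V) p).surjective
    ((mfderiv 𝓘(ℝ, V) 𝓘(ℝ, V) (extChartAt 𝓘(ℝ, V) (phaseProj F E p)) (phaseProj F E p)
      (𝓔.anchor _ a), ((Module.finBasis ℝ F).constr ℝ β).toContinuousLinearMap), s)
  have hanchor : 𝓔.anchor _ a = mfderiv (phaseModel V F) 𝓘(ℝ, V) (phaseProj F E) p v := by
    apply mfderiv_extChartAt_injective (I := 𝓘(ℝ, V))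
      (mem_extChartAt_source (I := 𝓘(ℝ, V)) (phaseProj F E p))
    rw [← phaseCoord_base (mem_phaseBase _), hv]
  refine ⟨⟨(a, v), hanchor⟩, rfl, fun k => ?_, ?_⟩
  · rw [← phaseCoord_fibre, hv]
    simp
  · rw [← phaseCoord_snd, hv]

end LieAlgebroid

end Contact

section Contact

variable {V F Q : Type*} [NormedAddCommGroup V] [NormedSpace ℝ V] [FiniteDimensional ℝ V]
  [NormedAddCommGroup F] [NormedSpace ℝ F] [FiniteDimensional ℝ F]
  [TopologicalSpace Q] [T2Space Q] [ChartedSpace V Q] [IsManifold 𝓘(ℝ, V) ∞ Q]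
  {E : Q → Type*} [∀ q, AddCommGroup (E q)] [∀ q, Module ℝ (E q)] [∀ q, TopologicalSpace (E q)]
  [TopologicalSpace (TotalSpace F E)] [FiberBundle F E] [VectorBundle ℝ F E]
  [ContMDiffVectorBundle ∞ F E 𝓘(ℝ, V)]

namespace LieAlgebroid

variable (𝓔 : LieAlgebroid V F E) {p : PhaseSpace F E}

theorem dOne_contactForm (φ : FrameAt V F E (phaseProj F E p))
    (z w : 𝓔.Prol (phaseModel V F) (phaseProj F E) p) :
    𝓔.contactProl.dOne 𝓔.contactForm p z w =
      ∑ k, φ.coord k _ z.1.1 * dirDeriv (phaseModel V F) (momentum (φ.sec k)) p w.1.2 -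
      ∑ k, φ.coord k _ w.1.1 * dirDeriv (phaseModel V F) (momentum (φ.sec k)) p z.1.2 +
      ∑ k, ∑ l, φ.coord k _ z.1.1 * φ.coord l _ w.1.1 *
        momentum (𝓔.bracket (φ.sec k) (φ.sec l)) p := by
  obtain ⟨Z, W, hZ, hW, rfl, rfl, hdOne⟩ := 𝓔.contactProl.exists_dOne_eq 𝓔.contactForm
    (𝓔.exists_prolSmooth z) (𝓔.exists_prolSmooth w)
  have hcont : Continuous (phaseProj F E) := (contMDiff_phaseProj (V := V)).continuous
  exact hdOne.trans ((hZ.isLocalExpansion_frame hcont.continuousAt φ)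
    |>.dirDeriv_contactForm_sub_bracket (hW.isLocalExpansion_frame hcont.continuousAt φ) hZ hW)

theorem dOne_contactForm_swap (z w : 𝓔.Prol (phaseModel V F) (phaseProj F E) p) :
    𝓔.contactProl.dOne 𝓔.contactForm p w z = -𝓔.contactProl.dOne 𝓔.contactForm p z w := by
  obtain ⟨φ⟩ := nonempty_frameAt (V := V) (F := F) (E := E) (phaseProj F E p)
  have hbracket : ∀ k l, momentum (𝓔.bracket (φ.sec k) (φ.sec l)) p =
      -momentum (𝓔.bracket (φ.sec l) (φ.sec k)) p := fun k l => by
    rw [𝓔.bracket_antisymm _ _ (φ.smooth_sec k) (φ.smooth_sec l)]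
    exact map_neg _ _
  have hsum : ∑ k, ∑ l, φ.coord k _ w.1.1 * φ.coord l _ z.1.1 *
      momentum (𝓔.bracket (φ.sec k) (φ.sec l)) p =
      -∑ k, ∑ l, φ.coord k _ z.1.1 * φ.coord l _ w.1.1 *
        momentum (𝓔.bracket (φ.sec k) (φ.sec l)) p := by
    rw [Finset.sum_comm]
    simp only [← Finset.sum_neg_distrib]
    refine Finset.sum_congr rfl fun k _ => Finset.sum_congr rfl fun l _ => ?_
    rw [hbracket l k]
    ring
  rw [𝓔.dOne_contactForm φ, 𝓔.dOne_contactForm φ, hsum]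
  ring

variable (p) in
/-- The value at `p` of the exterior differential `dη` of the contact `1`-section, as a bilinear
form on the fibre of the prolongation. -/
def contactDiff : LinearMap.BilinForm ℝ (𝓔.Prol (phaseModel V F) (phaseProj F E) p) :=
  have hadd : ∀ z z' w, 𝓔.contactProl.dOne 𝓔.contactForm p (z + z') w =
      𝓔.contactProl.dOne 𝓔.contactForm p z w + 𝓔.contactProl.dOne 𝓔.contactForm p z' w := by
    intro z z' w
    obtain ⟨φ⟩ := nonempty_frameAt (V := V) (F := F) (E := E) (phaseProj F E p)
    simp only [𝓔.dOne_contactForm φ, Submodule.coe_add, Prod.fst_add, Prod.snd_add, map_add,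
      add_mul, mul_add, Finset.sum_add_distrib]
    ring
  have hsmul : ∀ (c : ℝ) z w, 𝓔.contactProl.dOne 𝓔.contactForm p (c • z) w =
      c • 𝓔.contactProl.dOne 𝓔.contactForm p z w := by
    intro c z w
    obtain ⟨φ⟩ := nonempty_frameAt (V := V) (F := F) (E := E) (phaseProj F E p)
    simp only [𝓔.dOne_contactForm φ, Submodule.coe_smul, Prod.smul_fst, Prod.smul_snd, map_smul,
      smul_eq_mul, mul_assoc, mul_left_comm _ c, ← Finset.mul_sum]
    ring
  LinearMap.mk₂ ℝ (𝓔.contactProl.dOne 𝓔.contactForm p) hadd hsmul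
    (fun z w w' => by
      rw [dOne_contactForm_swap, hadd, neg_add, ← dOne_contactForm_swap, ← dOne_contactForm_swap])
    (fun c z w => by
      rw [dOne_contactForm_swap, hsmul, ← smul_neg, ← dOne_contactForm_swap])

variable (p) in
theorem isRefl_contactDiff : (𝓔.contactDiff p).IsRefl := fun z w h => by
  rw [contactDiff, LinearMap.mk₂_apply] at h ⊢
  rw [dOne_contactForm_swap, h, neg_zero]

variable {𝓔}

theorem contactDiff_of_fst_eq_zero (φ : FrameAt V F E (phaseProj F E p))
    {u : 𝓔.Prol (phaseModel V F) (phaseProj F E) p} (hu : u.1.1 = 0)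
    (w : 𝓔.Prol (phaseModel V F) (phaseProj F E) p) :
    𝓔.contactDiff p u w =
      -∑ k, φ.coord k _ w.1.1 * dirDeriv (phaseModel V F) (momentum (φ.sec k)) p u.1.2 := by
  rw [contactDiff, LinearMap.mk₂_apply, 𝓔.dOne_contactForm φ]
  simp only [hu, map_zero, zero_mul, Finset.sum_const_zero, zero_sub, add_zero]

theorem eq_zero_of_fst_eq_zero {u : 𝓔.Prol (phaseModel V F) (phaseProj F E) p}
    (hfst : u.1.1 = 0) (hη : 𝓔.contactForm p u = 0)
    (hdη : ∀ a, ∃ w : 𝓔.Prol (phaseModel V F) (phaseProj F E) p,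
      w.1.1 = a ∧ 𝓔.contactDiff p u w = 0) : u = 0 := by
  obtain ⟨φ⟩ := nonempty_frameAt (V := V) (F := F) (E := E) (phaseProj F E p)
  refine prol_ext φ hfst (fun l => Eq.trans ?_ (map_zero _).symm)
    (Eq.trans ?_ (map_zero _).symm)
  · obtain ⟨w, hw, hdηw⟩ := hdη (φ.sec l (phaseProj F E p))
    simpa [contactDiff_of_fst_eq_zero φ hfst, hw, φ.coord_sec] using hdηw
  · simpa [contactForm_apply, hfst] using hη

theorem eq_zero_of_contactDiff_eq_zero {z : 𝓔.Prol (phaseModel V F) (phaseProj F E) p}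
    (hη : 𝓔.contactForm p z = 0) (hdη : 𝓔.contactDiff p z = 0) : z = 0 := by
  obtain ⟨φ⟩ := nonempty_frameAt (V := V) (F := F) (E := E) (phaseProj F E p)
  have hcoord : ∀ k, φ.coord k _ z.1.1 = 0 := fun k => by
    obtain ⟨w, hw, hwμ, -⟩ := 𝓔.exists_prol φ 0 (Pi.single k 1) 0
    have hzw : 𝓔.contactDiff p w z = 0 :=
      (𝓔.isRefl_contactDiff p).eq_zero (LinearMap.congr_fun hdη w)
    simpa [contactDiff_of_fst_eq_zero φ hw, hwμ, Pi.single_apply] using hzw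
  refine eq_zero_of_fst_eq_zero ?_ hη fun a => ?_
  · rw [← φ.sum_coord.self_of_nhds z.1.1]
    exact Finset.sum_eq_zero fun k _ => by rw [hcoord, zero_smul]
  · obtain ⟨w, hw, -⟩ := 𝓔.exists_prol φ a 0 0
    exact ⟨w, hw, LinearMap.congr_fun hdη w⟩

variable (𝓔 p) in
theorem exists_reeb_vector : ∃ R : 𝓔.Prol (phaseModel V F) (phaseProj F E) p,
    𝓔.contactDiff p R = 0 ∧ 𝓔.contactForm p R = 1 := by
  obtain ⟨φ⟩ := nonempty_frameAt (V := V) (F := F) (E := E) (phaseProj F E p)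
  obtain ⟨R, hfst, hμ, hsnd⟩ := 𝓔.exists_prol φ 0 0 1
  refine ⟨R, LinearMap.ext fun w => ?_, ?_⟩
  · simp [contactDiff_of_fst_eq_zero φ hfst, hμ]
  · rw [contactForm_apply, hfst, hsnd, map_zero, sub_zero]

variable (𝓔) in
theorem isReeb_reeb :
    𝓔.contactProl.IsReeb 𝓔.contactForm (𝓔.contactProl.reeb 𝓔.contactForm) := by
  choose R hR using 𝓔.exists_reeb_vector
  exact Classical.epsilon_spec (p := 𝓔.contactProl.IsReeb 𝓔.contactForm)
    ⟨R, fun p => LinearMap.congr_fun (hR p).1, fun p => (hR p).2⟩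

theorem exists_hamiltonian_vector {R : 𝓔.Prol (phaseModel V F) (phaseProj F E) p}
    (hR : 𝓔.contactDiff p R = 0) (hηR : 𝓔.contactForm p R = 1) (s : ℝ)
    (Λ : Module.Dual ℝ (𝓔.Prol (phaseModel V F) (phaseProj F E) p)) :
    ∃ ξ, 𝓔.contactForm p ξ = s ∧ 𝓔.contactDiff p ξ = Λ - Λ R • 𝓔.contactForm p := by
  have := 𝓔.finiteDimensional_prol p
  have hΛ : (Λ - Λ R • 𝓔.contactForm p) R = 0 := by
    rw [LinearMap.sub_apply, LinearMap.smul_apply, hηR, smul_eq_mul, mul_one, sub_self]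
  have hnondeg : ∀ z, 𝓔.contactForm p z = 0 → 𝓔.contactDiff p z = 0 → z = 0 :=
    fun _ => eq_zero_of_contactDiff_eq_zero
  exact exists_eq_of_contact (𝓔.isRefl_contactDiff p) hR hηR hnondeg s hΛ

variable (𝓔) in
theorem isHamiltonian_hamiltonian (H : PhaseSpace F E → ℝ) :
    𝓔.contactProl.IsHamiltonian 𝓔.contactForm H
      (𝓔.contactProl.hamiltonian 𝓔.contactForm H) := by
  have hR : ∀ p, 𝓔.contactDiff p (𝓔.contactProl.reeb 𝓔.contactForm p) = 0 := fun p =>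
    LinearMap.ext (𝓔.isReeb_reeb.1 p)
  choose ξ hξ using fun p =>
    exists_hamiltonian_vector (hR p) (𝓔.isReeb_reeb.2 p) (-H p) (𝓔.contactProl.dFun H p)
  exact Classical.epsilon_spec (p := 𝓔.contactProl.IsHamiltonian 𝓔.contactForm H)
    ⟨ξ, fun p => (hξ p).1, fun p w => LinearMap.congr_fun (hξ p).2 w⟩

variable (𝓔)

theorem contactForm_evolutionSection (H : PhaseSpace F E → ℝ) (p : PhaseSpace F E) :
    𝓔.contactForm p (𝓔.evolutionSection H p) = 0 := by
  rw [evolutionSection, AlgebroidData.evolution, map_add, map_smul,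
    (𝓔.isHamiltonian_hamiltonian H).1, 𝓔.isReeb_reeb.2, smul_eq_mul, mul_one, neg_add_cancel]

theorem contactDiff_evolutionSection (H : PhaseSpace F E → ℝ)
    {w : 𝓔.Prol (phaseModel V F) (phaseProj F E) p} (hw : 𝓔.contactForm p w = 0) :
    𝓔.contactDiff p (𝓔.evolutionSection H p) w = 𝓔.contactProl.dFun H p w := by
  have hR : 𝓔.contactDiff p (𝓔.contactProl.reeb 𝓔.contactForm p) w = 0 := 𝓔.isReeb_reeb.1 p w
  have hξ : 𝓔.contactDiff p (𝓔.contactProl.hamiltonian 𝓔.contactForm H p) w = _ :=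
    (𝓔.isHamiltonian_hamiltonian H).2 p w
  rw [evolutionSection, AlgebroidData.evolution, map_add, map_smul, LinearMap.add_apply,
    LinearMap.smul_apply, hξ, hR, hw, mul_zero, sub_zero, smul_zero, add_zero]

end LieAlgebroid

end Contact

section Legendrian

variable {V F Q : Type*} [NormedAddCommGroup V] [NormedSpace ℝ V]
  [NormedAddCommGroup F] [NormedSpace ℝ F]
  [TopologicalSpace Q] [ChartedSpace V Q]
  {E : Q → Type*} [∀ q, AddCommGroup (E q)] [∀ q, Module ℝ (E q)] [∀ q, TopologicalSpace (E q)]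
  [TopologicalSpace (TotalSpace F E)] [FiberBundle F E] [VectorBundle ℝ F E]

theorem PhaseSection.contMDiff_fn (γ : PhaseSection V F E) : ContMDiff 𝓘(ℝ, V) 𝓘(ℝ, ℝ) ∞ γ.fn :=
  contMDiff_snd.comp γ.smooth

namespace LieAlgebroid

variable [IsManifold 𝓘(ℝ, V) ∞ Q] [ContMDiffVectorBundle ∞ F E 𝓘(ℝ, V)]
  {𝓔 : LieAlgebroid V F E} {γ : PhaseSection V F E} {q : Q}

theorem dirDeriv_graphMap {f : PhaseSpace F E → ℝ}
    (hf : MDifferentiableAt (phaseModel V F) 𝓘(ℝ, ℝ) f (γ.map q)) (a : E q) :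
    dirDeriv (phaseModel V F) f (γ.map q) (𝓔.graphMap γ q a).1.2 =
      dirDeriv 𝓘(ℝ, V) (f ∘ γ.map) q (𝓔.anchor q a) :=
  (dirDeriv_comp hf (γ.smooth.mdifferentiable (by simp) q) _).symm

theorem contactForm_graphMap (a : E q) :
    𝓔.contactForm (γ.map q) (𝓔.graphMap γ q a) =
      dirDeriv 𝓘(ℝ, V) γ.fn q (𝓔.anchor q a) - fibreForm (γ.map q) a := by
  have hsnd : MDifferentiableAt (phaseModel V F) 𝓘(ℝ, ℝ) Prod.snd (γ.map q) :=
    contMDiff_snd.mdifferentiableAt one_ne_zero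
  rw [contactForm_apply, dirDeriv_graphMap hsnd]
  rfl

section Vanishing

variable (hη : ∀ q a, 𝓔.contactForm (γ.map q) (𝓔.graphMap γ q a) = 0)
include hη

theorem momentum_comp_map (σ : ∀ q, E q) : momentum σ ∘ γ.map = 𝓔.act σ γ.fn :=
  funext fun q => (sub_eq_zero.1 ((contactForm_graphMap _).symm.trans (hη q (σ q)))).symm

variable [FiniteDimensional ℝ F]

theorem dirDeriv_momentum_graphMap {σ : ∀ q, E q} (hσ : SmoothSection V F σ)
    (φ : FrameAt V F E q) (a : E q) :
    dirDeriv (phaseModel V F) (momentum σ) (γ.map q) (𝓔.graphMap γ q a).1.2 =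
      ∑ l, φ.coord l q a * 𝓔.act (φ.sec l) (𝓔.act σ γ.fn) q := by
  rw [dirDeriv_graphMap ((contMDiff_momentum hσ).mdifferentiable (by simp) _),
    momentum_comp_map hη]
  conv_lhs => rw [← φ.sum_coord.self_of_nhds a]
  simp only [map_sum, map_smul, smul_eq_mul, act]

variable [FiniteDimensional ℝ V] [T2Space Q]

theorem contactDiff_graphMap (a b : E q) :
    𝓔.contactDiff (γ.map q) (𝓔.graphMap γ q a) (𝓔.graphMap γ q b) = 0 := by
  obtain ⟨φ⟩ := nonempty_frameAt (V := V) (F := F) (E := E) q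
  have hmomentum : ∀ k l, momentum (𝓔.bracket (φ.sec k) (φ.sec l)) (γ.map q) =
      𝓔.act (φ.sec k) (𝓔.act (φ.sec l) γ.fn) q - 𝓔.act (φ.sec l) (𝓔.act (φ.sec k) γ.fn) q :=
    fun k l => (congrFun (momentum_comp_map hη _) q).trans
      (𝓔.act_bracket γ.contMDiff_fn (φ.smooth_sec k) (φ.smooth_sec l) q)
  have hcomm : ∑ k, ∑ l, φ.coord k q b * φ.coord l q a *
      𝓔.act (φ.sec l) (𝓔.act (φ.sec k) γ.fn) q =
      ∑ k, ∑ l, φ.coord k q a * φ.coord l q b *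
        𝓔.act (φ.sec k) (𝓔.act (φ.sec l) γ.fn) q :=
    Finset.sum_comm.trans <| Finset.sum_congr rfl fun k _ => Finset.sum_congr rfl fun l _ => by
      rw [mul_comm (φ.coord l q b)]
  have hdη : 𝓔.contactDiff (γ.map q) (𝓔.graphMap γ q a) (𝓔.graphMap γ q b) =
      ∑ k, φ.coord k q a *
        dirDeriv (phaseModel V F) (momentum (φ.sec k)) (γ.map q) (𝓔.graphMap γ q b).1.2 -
      ∑ k, φ.coord k q b *
        dirDeriv (phaseModel V F) (momentum (φ.sec k)) (γ.map q) (𝓔.graphMap γ q a).1.2 +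
      ∑ k, ∑ l, φ.coord k q a * φ.coord l q b *
        momentum (𝓔.bracket (φ.sec k) (φ.sec l)) (γ.map q) :=
    𝓔.dOne_contactForm (p := γ.map q) φ _ _
  simp only [hdη, dirDeriv_momentum_graphMap hη (φ.smooth_sec _) φ, hmomentum, mul_sub,
    Finset.sum_sub_distrib, Finset.mul_sum, ← mul_assoc, hcomm]
  ring

theorem eq_graphMap_of_contactDiff_eq_zero
    {z : 𝓔.Prol (phaseModel V F) (phaseProj F E) (γ.map q)} {a : E q} (hza : z.1.1 = a)
    (hηz : 𝓔.contactForm (γ.map q) z = 0)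
    (hdη : ∀ b, 𝓔.contactDiff (γ.map q) z (𝓔.graphMap γ q b) = 0) : z = 𝓔.graphMap γ q a := by
  refine sub_eq_zero.1 (eq_zero_of_fst_eq_zero (sub_eq_zero.2 hza) ?_
    fun b : E q => ⟨𝓔.graphMap γ q b, rfl, ?_⟩)
  · rw [map_sub, hηz, hη, sub_zero]
  · rw [map_sub, LinearMap.sub_apply, hdη, contactDiff_graphMap hη, sub_zero]

end Vanishing

end LieAlgebroid

end Legendrian

end

theorem mainTheorem8_general
    {V F Q : Type*} [NormedAddCommGroup V] [NormedSpace ℝ V] [FiniteDimensional ℝ V]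
    [NormedAddCommGroup F] [NormedSpace ℝ F] [FiniteDimensional ℝ F]
    [TopologicalSpace Q] [T2Space Q] [ChartedSpace V Q] [IsManifold 𝓘(ℝ, V) ∞ Q]
    {E : Q → Type*} [∀ q, AddCommGroup (E q)] [∀ q, Module ℝ (E q)]
    [∀ q, TopologicalSpace (E q)] [TopologicalSpace (TotalSpace F E)]
    [FiberBundle F E] [VectorBundle ℝ F E] [ContMDiffVectorBundle ∞ F E 𝓘(ℝ, V)]
    (𝓔 : LieAlgebroid V F E)
    (H : PhaseSpace F E → ℝ) (hH : MDifferentiable (phaseModel V F) 𝓘(ℝ, ℝ) H)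
    (γ : PhaseSection V F E)
    (hη : ∀ q a, 𝓔.contactForm (γ.map q) (𝓔.graphMap γ q a) = 0) :
    𝓔.GammaRelated γ (𝓔.evolutionSection H)
        (𝓔.inducedSection γ (𝓔.evolutionSection H)) ↔
      ∀ q, 𝓔.data.dFun (H ∘ γ.map) q = 0 := by
  have hdη : ∀ q a, 𝓔.contactDiff (γ.map q) (𝓔.evolutionSection H (γ.map q))
      (𝓔.graphMap γ q a) = 𝓔.data.dFun (H ∘ γ.map) q a := fun q a =>
    (𝓔.contactDiff_evolutionSection H (hη q a)).trans
      (LieAlgebroid.dirDeriv_graphMap (hH (γ.map q)) a)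
  constructor
  · intro hrel q
    ext a
    rw [← hdη, hrel q, LieAlgebroid.contactDiff_graphMap hη, LinearMap.zero_apply]
  · intro hdH q
    refine LieAlgebroid.eq_graphMap_of_contactDiff_eq_zero hη rfl
      (𝓔.contactForm_evolutionSection H _) fun a => ?_
    rw [hdη, hdH, LinearMap.zero_apply]

theorem mainTheorem8
    {V F Q : Type*} [NormedAddCommGroup V] [NormedSpace ℝ V] [FiniteDimensional ℝ V]
    [NormedAddCommGroup F] [NormedSpace ℝ F] [FiniteDimensional ℝ F]
    [TopologicalSpace Q] [T2Space Q] [ChartedSpace V Q] [IsManifold 𝓘(ℝ, V) ∞ Q]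
    {E : Q → Type*} [∀ q, AddCommGroup (E q)] [∀ q, Module ℝ (E q)]
    [∀ q, TopologicalSpace (E q)] [TopologicalSpace (TotalSpace F E)]
    [FiberBundle F E] [VectorBundle ℝ F E] [ContMDiffVectorBundle ∞ F E 𝓘(ℝ, V)]
    (𝓔 : LieAlgebroid V F E)
    (H : PhaseSpace F E → ℝ) (hH : ContMDiff (phaseModel V F) 𝓘(ℝ, ℝ) ∞ H)
    (γ : PhaseSection V F E) (hγ : 𝓔.IsLegendrianSection γ) :
    𝓔.GammaRelated γ (𝓔.evolutionSection H)
        (𝓔.inducedSection γ (𝓔.evolutionSection H)) ↔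
      ∀ q, 𝓔.data.dFun (H ∘ γ.map) q = 0 :=
  mainTheorem8_general 𝓔 H (hH.mdifferentiable (by simp)) γ hγ.vanishes
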